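/- **Setting.** Let $S$ be a complex K3 surface, $p$ a prime, and let $w\in H^2(S,\mathbb Z)$ represent a class in $H^2(S,\mu_p)=H^2(S,\mathbb Z)/pH^2(S,\mathbb Z)$. Write $w^2\in\mathbb Z$ for its self-intersection number (the cup square, evaluated on a fundamental class of $S$), and put $\delta_{w,0}=1$ if $w\in pH^2(S,\mathbb Z)$ and $\delta_{w,0}=0$ otherwise. For $\tau$ in the upper half-plane let $q=e^{2\pi i\tau}$, $q^{n/p}=e^{2\pi i n\tau/p}$, $\zeta_p=e^{2\pi i/p}$, and $\eta(q)=q^{1/24}\prod_{n\ge1}(1-q^n)$. Let $\eta(q)^{-24}=\sum_{n\in\mathbb Z}a(n)q^n$, and let $\alpha_{2,p}(w;n)$, $n\in\mathbb Z$, be the coefficients of $$Z_w(q)=\sum_{n\in\mathbb Z}\alpha_{2,p}(w;n)\,q^{n/p}:=\frac{\delta_{w,0}}{p^2}\,\eta(q^p)^{-24}+\frac1p\sum_{j=0}^{p-1}e^{-\pi i j w^2/p}\,\eta\big(\zeta_p^j q^{1/p}\big)^{-24}.$$ Put $\alpha'_{2,p}(w;n)=\alpha_{2,p}(w;pn)$,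 and let $I_{13}$ be the modified Bessel function of the first kind of order $13$. **Corollary.** Suppose that $w^2=2m$ is an even integer and $p\mid m$. Then: 1. $Z_w(q)$ contains only integral powers of $q$: $\alpha_{2,p}(w;n)=0$ whenever $p\nmid n$, and $$Z_w(q)=\sum_{n\in\mathbb Z}\alpha'_{2,p}(w;n)\,q^n .$$ 2. For every $n\in\mathbb Z$, $$\alpha'_{2,p}(w;n)=a(pn)+\begin{cases}\dfrac{\delta_{w,0}}{p^2}\,a\!\left(\dfrac np\right)&\text{if } p\mid n,\\[2mm] 0&\text{otherwise.}\end{cases}$$ 3. As $n\to\infty$, $\alpha'_{2,p}(w;n)\sim a(pn)$ and $$\alpha'_{2,p}(w;n)=\frac{2\pi}{(pn)^{13/2}}\,I_{13}\!\left(4\pi\sqrt{pn}\right)\left(1+O_p\!\left(e^{-2\pi\sqrt{pn}}\right)\right),$$ where the implied constant depends only on $p$ (not on $S$ or $w$). -/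

import Mathlib

open Filter Asymptotics
open scoped ContDiff Manifold Topology

noncomputable section

namespace VW

/-! ### Integral singular cohomology and the cup product on second cohomology -/

section Cohomology

variable (S : Type*) [TopologicalSpace S]

/-- Singular `n`-simplices of `S`. -/
abbrev Simplex (n : ℕ) : Type _ := C(stdSimplex ℝ (Fin (n + 1)), S)

/-- Integral singular `n`-cochains of `S`, that is, `Hom(C_n(S), ℤ)`. -/
abbrev Cochain (n : ℕ) : Type _ := Simplex S n → ℤ

variable {S}

/-- The simplex with vertices `σ (φ 0), …, σ (φ m)`: the composite of `σ` with the affine map of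
standard simplices that sends the vertex `e_i` to the vertex `e_(φ i)`. -/
def Simplex.sub {m n : ℕ} (σ : Simplex S n) (φ : Fin (m + 1) → Fin (n + 1)) : Simplex S m :=
  σ.comp ⟨stdSimplex.map φ, stdSimplex.continuous_map φ⟩

theorem Simplex.sub_sub {l m n : ℕ} (σ : Simplex S n) (φ : Fin (m + 1) → Fin (n + 1))
    (ψ : Fin (l + 1) → Fin (m + 1)) : (σ.sub φ).sub ψ = σ.sub (φ ∘ ψ) := by
  ext x
  simp [Simplex.sub, stdSimplex.map_comp_apply]

variable (S)

/-- The coboundary `(d f)(σ) = ∑ i, (-1)^i f (i-th face of σ)`. -/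
def d (n : ℕ) : Cochain S n →ₗ[ℤ] Cochain S (n + 1) where
  toFun f σ := ∑ i : Fin (n + 2), (-1) ^ (i : ℕ) * f (σ.sub i.succAbove)
  map_add' f g := by
    ext σ
    simp [mul_add, Finset.sum_add_distrib]
  map_smul' c f := by
    ext σ
    simp [Finset.mul_sum, mul_left_comm]

/-- Singular cocycles. -/
def cocycles (n : ℕ) : Submodule ℤ (Cochain S n) := LinearMap.ker (d S n)

/-- Singular coboundaries. -/
def coboundaries : ∀ n : ℕ, Submodule ℤ (Cochain S n)
  | 0 => ⊥
  | n + 1 => LinearMap.range (d S n)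

/-- Integral singular cohomology `H^n(S, ℤ)`: cocycles modulo coboundaries. -/
abbrev H (n : ℕ) : Type _ := cocycles S n ⧸ (coboundaries S n).comap (cocycles S n).subtype

variable {S}

/-- The cup product of cochains: front face times back face. -/
def cup {k l : ℕ} (f : Cochain S k) (g : Cochain S l) : Cochain S (k + l) := fun σ =>
  f (σ.sub (fun i => Fin.castLE (by omega) i)) * g (σ.sub (fun i => Fin.natAdd k i))

theorem d_1_apply (f : Cochain S 1) (σ : Simplex S 2) : d S 1 f σ =
    f (σ.sub ![1, 2]) - f (σ.sub ![0, 2]) + f (σ.sub ![0, 1]) := by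
  have e0 : (Fin.succ : Fin 2 → Fin 3) = ![1, 2] := by decide
  have e1 : (1 : Fin 3).succAbove = ![0, 2] := by decide
  have e2 : (2 : Fin 3).succAbove = ![0, 1] := by decide
  simp [d, Fin.sum_univ_succ, e0, e1, e2]
  ring

theorem d_2_apply (f : Cochain S 2) (σ : Simplex S 3) : d S 2 f σ =
    f (σ.sub ![1, 2, 3]) - f (σ.sub ![0, 2, 3]) + f (σ.sub ![0, 1, 3])
      - f (σ.sub ![0, 1, 2]) := by
  have e0 : (Fin.succ : Fin 3 → Fin 4) = ![1, 2, 3] := by decide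
  have e1 : (1 : Fin 4).succAbove = ![0, 2, 3] := by decide
  have e2 : (2 : Fin 4).succAbove = ![0, 1, 3] := by decide
  have e3 : (3 : Fin 4).succAbove = ![0, 1, 2] := by decide
  simp [d, Fin.sum_univ_succ, e0, e1, e2, e3]
  ring

theorem d_3_apply (f : Cochain S 3) (σ : Simplex S 4) : d S 3 f σ =
    f (σ.sub ![1, 2, 3, 4]) - f (σ.sub ![0, 2, 3, 4]) + f (σ.sub ![0, 1, 3, 4])
      - f (σ.sub ![0, 1, 2, 4]) + f (σ.sub ![0, 1, 2, 3]) := by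
  have e0 : (Fin.succ : Fin 4 → Fin 5) = ![1, 2, 3, 4] := by decide
  have e1 : (1 : Fin 5).succAbove = ![0, 2, 3, 4] := by decide
  have e2 : (2 : Fin 5).succAbove = ![0, 1, 3, 4] := by decide
  have e3 : (3 : Fin 5).succAbove = ![0, 1, 2, 4] := by decide
  have e4 : (4 : Fin 5).succAbove = ![0, 1, 2, 3] := by decide
  simp [d, Fin.sum_univ_succ, e0, e1, e2, e3, e4]
  ring

theorem d_4_apply (f : Cochain S 4) (σ : Simplex S 5) : d S 4 f σ =
    f (σ.sub ![1, 2, 3, 4, 5]) - f (σ.sub ![0, 2, 3, 4, 5]) + f (σ.sub ![0, 1, 3, 4, 5])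
      - f (σ.sub ![0, 1, 2, 4, 5]) + f (σ.sub ![0, 1, 2, 3, 5]) - f (σ.sub ![0, 1, 2, 3, 4]) := by
  have e0 : (Fin.succ : Fin 5 → Fin 6) = ![1, 2, 3, 4, 5] := by decide
  have e1 : (1 : Fin 6).succAbove = ![0, 2, 3, 4, 5] := by decide
  have e2 : (2 : Fin 6).succAbove = ![0, 1, 3, 4, 5] := by decide
  have e3 : (3 : Fin 6).succAbove = ![0, 1, 2, 4, 5] := by decide
  have e4 : (4 : Fin 6).succAbove = ![0, 1, 2, 3, 5] := by decide
  have e5 : (5 : Fin 6).succAbove = ![0, 1, 2, 3, 4] := by decide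
  simp [d, Fin.sum_univ_succ, e0, e1, e2, e3, e4, e5]
  ring

theorem cup_1_2_apply (f : Cochain S 1) (g : Cochain S 2) (σ : Simplex S 3) :
    cup f g σ = f (σ.sub ![0, 1]) * g (σ.sub ![1, 2, 3]) := by
  have e1 : (fun i : Fin 2 => Fin.castLE (by omega : 2 ≤ 4) i) = ![0, 1] := by decide
  have e2 : (fun i : Fin 3 => (Fin.natAdd 1 i : Fin 4)) = ![1, 2, 3] := by decide
  unfold cup
  rw [← e1, ← e2]

theorem cup_2_1_apply (f : Cochain S 2) (g : Cochain S 1) (σ : Simplex S 3) :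
    cup f g σ = f (σ.sub ![0, 1, 2]) * g (σ.sub ![2, 3]) := by
  have e1 : (fun i : Fin 3 => Fin.castLE (by omega : 3 ≤ 4) i) = ![0, 1, 2] := by decide
  have e2 : (fun i : Fin 2 => (Fin.natAdd 2 i : Fin 4)) = ![2, 3] := by decide
  unfold cup
  rw [← e1, ← e2]

theorem cup_2_2_apply (f : Cochain S 2) (g : Cochain S 2) (σ : Simplex S 4) :
    cup f g σ = f (σ.sub ![0, 1, 2]) * g (σ.sub ![2, 3, 4]) := by
  have e1 : (fun i : Fin 3 => Fin.castLE (by omega : 3 ≤ 5) i) = ![0, 1, 2] := by decide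
  have e2 : (fun i : Fin 3 => (Fin.natAdd 2 i : Fin 5)) = ![2, 3, 4] := by decide
  unfold cup
  rw [← e1, ← e2]

theorem comp_vec_two {m n : ℕ} (v : Fin m → Fin n) (a b : Fin m) :
    v ∘ ![a, b] = ![v a, v b] := by
  ext i
  fin_cases i <;> rfl

theorem comp_vec_three {m n : ℕ} (v : Fin m → Fin n) (a b c : Fin m) :
    v ∘ ![a, b, c] = ![v a, v b, v c] := by
  ext i
  fin_cases i <;> rfl

theorem d_cup_two_two (f g : Cochain S 2) (hf : d S 2 f = 0) (hg : d S 2 g = 0) :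
    d S 4 (cup f g) = 0 := by
  ext σ
  have h1 := congrFun hf (σ.sub ![0, 1, 2, 3])
  have h2 := congrFun hg (σ.sub ![2, 3, 4, 5])
  simp [d_2_apply, Simplex.sub_sub, comp_vec_three] at h1 h2
  simp [d_4_apply, cup_2_2_apply, Simplex.sub_sub, comp_vec_three]
  linear_combination g (σ.sub ![3, 4, 5]) * h1 + f (σ.sub ![0, 1, 2]) * h2

theorem d_cup_one_two (f : Cochain S 1) (g : Cochain S 2) (hg : d S 2 g = 0) :
    d S 3 (cup f g) = cup (d S 1 f) g := by
  ext σ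
  have h2 := congrFun hg (σ.sub ![1, 2, 3, 4])
  simp [d_2_apply, Simplex.sub_sub, comp_vec_three] at h2
  simp [d_1_apply, d_3_apply, cup_1_2_apply, cup_2_2_apply, Simplex.sub_sub, comp_vec_two, comp_vec_three]
  linear_combination (-f (σ.sub ![0, 1])) * h2

theorem d_cup_two_one (f : Cochain S 2) (g : Cochain S 1) (hf : d S 2 f = 0) :
    d S 3 (cup f g) = cup f (d S 1 g) := by
  ext σ
  have h1 := congrFun hf (σ.sub ![0, 1, 2, 3])
  simp [d_2_apply, Simplex.sub_sub, comp_vec_three] at h1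
  simp [d_1_apply, d_3_apply, cup_2_1_apply, cup_2_2_apply, Simplex.sub_sub, comp_vec_two, comp_vec_three]
  linear_combination g (σ.sub ![3, 4]) * h1

/-- The class in `H^4` of the cup product of two `2`-cocycles. -/
def cupCocycles : cocycles S 2 →ₗ[ℤ] cocycles S 2 →ₗ[ℤ] H S 4 :=
  LinearMap.mk₂ ℤ (fun f g => Submodule.Quotient.mk
      ⟨cup f.1 g.1, d_cup_two_two f.1 g.1 f.2 g.2⟩)
    (fun f f' g => by
      rw [← Submodule.Quotient.mk_add]; congr 1; ext σ; simp [cup, add_mul])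
    (fun c f g => by
      rw [← Submodule.Quotient.mk_smul]; congr 1; ext σ; simp [cup, mul_assoc])
    (fun f g g' => by
      rw [← Submodule.Quotient.mk_add]; congr 1; ext σ; simp [cup, mul_add])
    (fun c f g => by
      rw [← Submodule.Quotient.mk_smul]; congr 1; ext σ; simp [cup, mul_left_comm])

/-- The cup product `H^2(S, ℤ) × H^2(S, ℤ) → H^4(S, ℤ)`. -/
def cupProduct : H S 2 →ₗ[ℤ] H S 2 →ₗ[ℤ] H S 4 :=
  Submodule.liftQ _
    (LinearMap.flip (Submodule.liftQ _ (LinearMap.flip cupCocycles) (by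
      rintro g ⟨b, hb⟩
      rw [LinearMap.mem_ker]
      ext f
      simp only [LinearMap.flip_apply, cupCocycles, LinearMap.mk₂_apply, LinearMap.zero_apply,
        Submodule.Quotient.mk_eq_zero]
      refine ⟨cup f.1 b, ?_⟩
      rw [d_cup_two_one f.1 b f.2, hb]
      rfl)))
    (by
      rintro f ⟨b, hb⟩
      rw [LinearMap.mem_ker]
      ext g
      simp only [LinearMap.flip_apply, LinearMap.comp_apply, Submodule.mkQ_apply,
        Submodule.liftQ_apply, cupCocycles, LinearMap.mk₂_apply, LinearMap.zero_apply,
        Submodule.Quotient.mk_eq_zero]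
      refine ⟨cup b g.1, ?_⟩
      rw [d_cup_one_two b g.1 g.2, hb]
      rfl)

/-- The self-intersection number `w² = w · w` of `w ∈ H²(S, ℤ)`: the cup square of `w`, read as an
integer through an isomorphism `H⁴(S, ℤ) ≅ ℤ` (evaluation on a fundamental class). -/
def selfIntersection (deg : H S 4 ≃+ ℤ) (w : H S 2) : ℤ := deg (cupProduct w w)

open Classical in
/-- `δ_{a,b}` is `1` if `a - b ∈ p H²(S, ℤ)`, that is, if `a` and `b` have the same class in
`H²(S, ℤ) / p H²(S, ℤ) = H²(S, μ_p)`, and `0` otherwise. -/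
def delta (p : ℕ) (a b : H S 2) : ℂ := if ∃ v : H S 2, a - b = p • v then 1 else 0

end Cohomology

/-! ### K3 surfaces -/

section K3

/-- The model space `ℂ²` of complex surfaces. -/
abbrev C2 : Type := EuclideanSpace ℂ (Fin 2)

variable (S : Type*) [TopologicalSpace S] [ChartedSpace C2 S]

/-- The canonical bundle of the complex surface `S` is trivial: there is a nowhere vanishing
holomorphic `2`-form. In a chart `e` the form is `f e · dz₁ ∧ dz₂`, with `f e` holomorphic and
nowhere zero on the target of `e`, and these expressions are related by the Jacobian determinants
of the transition maps. -/
def TrivialCanonicalBundle : Prop :=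
  ∃ f : OpenPartialHomeomorph S C2 → C2 → ℂ,
    (∀ e ∈ atlas C2 S, DifferentiableOn ℂ (f e) e.target ∧ ∀ z ∈ e.target, f e z ≠ 0) ∧
    ∀ e ∈ atlas C2 S, ∀ e' ∈ atlas C2 S, ∀ z ∈ (e.symm.trans e').source,
      f e z = f e' (e' (e.symm z)) * (fderiv ℂ (fun y => e' (e.symm y)) z).det

/-- A (complex) K3 surface: a compact, simply connected complex manifold of dimension two with
trivial canonical bundle. -/
structure IsK3Surface : Prop where
  compact : CompactSpace S
  hausdorff : T2Space S
  holomorphic : IsManifold 𝓘(ℂ, C2) ω S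
  simplyConnected : SimplyConnectedSpace S
  trivialCanonical : TrivialCanonicalBundle S

end K3

/-! ### Fourier coefficients and the partition function -/

/-- The coefficient of `q^(n/h)`, `q = e^(2πiτ)`, in the Fourier expansion of a function `F` that
is holomorphic on the upper half-plane and satisfies `F (τ + h) = F τ`. The integral over one
period is taken on the line `Im τ = 1`; for such `F` it does not depend on the line. -/
def fourierCoefficient (h : ℕ) (F : ℂ → ℂ) (n : ℤ) : ℂ :=
  (1 / (h : ℂ)) * ∫ x in (0 : ℝ)..h,
    F (x + Complex.I) * Complex.exp (-(2 * Real.pi * Complex.I * n * (x + Complex.I) / h))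

/-- `a(n)`, the `n`-th Fourier coefficient of `η(q)^(-24)`. -/
def a (n : ℤ) : ℂ := fourierCoefficient 1 (fun τ => ModularForm.eta τ ^ (-24 : ℤ)) n

section Partition

variable {S : Type*} [TopologicalSpace S]

/-- The partition function `Z_w(q)` at `q = e^(2πiτ)`:
`δ_{w,0} p^(-2) η(q^p)^(-24) + p^(-1) ∑_{0 ≤ j < p} e^(-πijw²/p) η(ζ_p^j q^(1/p))^(-24)`.
Here `q^p` and `ζ_p^j q^(1/p)` are the nomes of `pτ` and `(τ + j)/p`. -/
def Z (p : ℕ) (deg : H S 4 ≃+ ℤ) (w : H S 2) (τ : ℂ) : ℂ :=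
  delta p w 0 / (p : ℂ) ^ 2 * ModularForm.eta (p * τ) ^ (-24 : ℤ) +
  1 / (p : ℂ) * ∑ j ∈ Finset.range p,
    Complex.exp (-(Real.pi * Complex.I * j * (selfIntersection deg w : ℂ) / p)) *
      ModularForm.eta ((τ + j) / p) ^ (-24 : ℤ)

/-- `α_{2,p}(w; n)`, the coefficient of `q^(n/p)` in `Z_w(q)`. -/
def alpha2 (p : ℕ) (deg : H S 4 ≃+ ℤ) (w : H S 2) (n : ℤ) : ℂ :=
  fourierCoefficient p (Z p deg w) n

/-- `α'_{2,p}(w; n) = α_{2,p}(w; pn)`. -/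
def alpha2' (p : ℕ) (deg : H S 4 ≃+ ℤ) (w : H S 2) (n : ℤ) : ℂ := alpha2 p deg w (p * n)

end Partition

/-- The modified Bessel function `I_ν` of the first kind, of integer order `ν ≥ 0`. -/
def besselI (ν : ℕ) (x : ℝ) : ℝ :=
  ∑' k : ℕ, (x / 2) ^ (2 * k + ν) / ((k.factorial : ℝ) * ((k + ν).factorial : ℝ))

end VW

end

/-! The algebraic half is a root-of-unity filter. If $2p \mid w^2$, every phase in `Z` equals $1$
(`Z_eq`). The sum over $j$ then averages $\eta^{-24}$ over the translates $(\tau+j)/p$, which keeps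
exactly the exponents divisible by $p$ (`hasSum_sum_eta_div`), while $\eta(q^p)^{-24}$ lives on
exponents divisible by $p^2$ in the variable $q^{1/p}$. Orthogonality of characters identifies these
absolutely convergent series with the coefficients defined by integrals
(`fourierCoefficient_eq_of_hasSum`).

The analytic half is a circle method for $a(n)$ on a single horizontal line of height $y$. Since
$\eta^{-24}$ has weight $-12$, near the cusp $0$ it is $\tau^{12}e^{2\pi i/\tau}$ up to a bounded
error. The integral of this polar part over one period is the Bessel term, up to $O(e^{2\pi n y})$
(`norm_integral_polarIntegrand_sub_mainTerm_le`). Of the remaining cusps only $\pm 1/2$ matter.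
There $\eta^{-24}$ has size $y^{12}e^{\pi/(2y)}$ under a Gaussian of width about $y^{3/2}$.
Everything else is $O(e^{\pi/(4y)})$ (`exists_norm_eta_zpow_sub_polar_le`).

The height $y = 1/(2\sqrt n)$ minimises $2\pi n y + \pi/(2y)$ and gives the error $e^{2\pi\sqrt
n}\,n^{-27/4}$. The Gaussian is essential: its width supplies the last factor $n^{-3/4}$. Since
$I_{13}(x)$ is of exact order $e^x/\sqrt x$ (`besselI_le`, `eventually_le_besselI`), the main term
has order $e^{4\pi\sqrt n}\,n^{-27/4}$. The powers of $n$ cancel, and the relative error is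
$O(e^{-2\pi\sqrt n})$ with no polynomial loss.

Finally, if $n = pk$ then $a(n/p) = a(k)$ has size $e^{4\pi\sqrt k}$, whereas the admissible error
at $pn = p^2k$ has size $e^{2\pi p\sqrt k}$. As $p \ge 2$, the extra term is absorbed
(`exists_norm_a_le_mul_mainTerm`). -/

/-! ### Coefficients of absolutely convergent Fourier series -/

open Complex in
/-- Orthogonality of the characters of `ℝ / hℤ`, on a horizontal line. -/
theorem integral_exp_int_mul (h : ℕ) (hh : h ≠ 0) (k : ℤ) (t y : ℝ) :
    ∫ x in t..(t + h), exp (2 * Real.pi * I * k * (x + y * I) / h) = if k = 0 then (h : ℂ) else 0 := by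
  have hh' : (h : ℂ) ≠ 0 := by exact_mod_cast hh
  split_ifs with hk
  · simp [hk]
  · have hk' : (k : ℂ) ≠ 0 := by exact_mod_cast hk
    have hc : 2 * Real.pi * I * k / h ≠ 0 := by
      have := Real.pi_ne_zero
      simp [hk', hh', this]
    have e : ∀ x : ℝ, exp (2 * Real.pi * I * k * (x + y * I) / h) =
        exp (2 * Real.pi * I * k / h * (y * I)) * exp (2 * Real.pi * I * k / h * x) := by
      intro x
      rw [← exp_add]; congr 1; ring
    simp_rw [e]
    rw [intervalIntegral.integral_const_mul, integral_exp_mul_complex hc]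
    have : exp (2 * Real.pi * I * k / h * (t + h : ℝ)) = exp (2 * Real.pi * I * k / h * t) := by
      rw [← exp_periodic.int_mul k (2 * Real.pi * I * k / h * t)]
      congr 1; push_cast; field_simp
    rw [this]; simp

open Complex in
/-- The coefficients of an absolutely convergent Fourier series on a horizontal line. -/
theorem integral_mul_exp_of_hasSum {h : ℕ} (hh : h ≠ 0) {F : ℂ → ℂ} {c : ℤ → ℂ} {y : ℝ}
    (H : ∀ x : ℝ, HasSum (fun n : ℤ => c n * exp (2 * Real.pi * I * n * (x + y * I) / h))
      (F (x + y * I))) (t : ℝ) (m : ℤ) :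
    ∫ x in t..(t + h), F (x + y * I) * exp (-(2 * Real.pi * I * m * (x + y * I) / h)) = h * c m := by
  have key : ∀ (n : ℤ) (x : ℝ), c n * exp (2 * Real.pi * I * n * (x + y * I) / h) *
      exp (-(2 * Real.pi * I * m * (x + y * I) / h)) =
      c n * exp (2 * Real.pi * I * (n - m : ℤ) * (x + y * I) / h) := by
    intro n x
    rw [mul_assoc, ← exp_add]; congr 2; push_cast; ring
  have nrm : ∀ (n : ℤ) (x : ℝ), ‖exp (2 * Real.pi * I * n * (x + y * I) / h)‖ =
      ‖exp (2 * Real.pi * I * n * ((0 : ℝ) + y * I) / h)‖ := by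
    intro n x
    simp only [norm_exp]
    congr 1
    have : ∀ x : ℝ, 2 * Real.pi * I * n * (x + y * I) / h =
      ((2 * Real.pi * n * x / h : ℝ) : ℂ) * I - ((2 * Real.pi * n * y / h : ℝ) : ℂ) := by
      intro x; push_cast; linear_combination (2 * Real.pi * n * y / h : ℂ) * I_sq
    rw [this, this]; simp
  have hs := intervalIntegral.hasSum_integral_of_dominated_convergence
    (μ := MeasureTheory.volume) (a := t) (b := t + h)
    (F := fun (n : ℤ) (x : ℝ) => c n * exp (2 * Real.pi * I * n * (x + y * I) / h) *
      exp (-(2 * Real.pi * I * m * (x + y * I) / h)))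
    (f := fun x : ℝ => F (x + y * I) * exp (-(2 * Real.pi * I * m * (x + y * I) / h)))
    (fun n _ => ‖c n * exp (2 * Real.pi * I * n * ((0 : ℝ) + y * I) / h)‖ *
      ‖exp (2 * Real.pi * I * (-m : ℤ) * ((0 : ℝ) + y * I) / h)‖)
    (fun n => by
      apply Continuous.aestronglyMeasurable
      fun_prop)
    (fun n => .of_forall fun x _ => by
      rw [norm_mul, norm_mul, norm_mul, nrm n x, ← nrm (-m) x]
      apply le_of_eq; congr 3; push_cast; ring)
    (.of_forall fun x _ => ((H 0).summable.norm.mul_right _))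
    (by simp)
    (.of_forall fun x _ => (H x).mul_right _)
  simp_rw [key, intervalIntegral.integral_const_mul, integral_exp_int_mul h hh, sub_eq_zero] at hs
  refine hs.unique ?_
  convert hasSum_single m ?_ using 1
  · simp [mul_comm]
  · intro n hn; simp [hn]

theorem fourierCoefficient_eq_of_hasSum {h : ℕ} (hh : h ≠ 0) {F : ℂ → ℂ} {c : ℤ → ℂ}
    (H : ∀ τ : ℂ, 0 < τ.im →
      HasSum (fun n : ℤ => c n * Complex.exp (2 * Real.pi * Complex.I * n * τ / h)) (F τ)) (m : ℤ) :
    VW.fourierCoefficient h F m = c m := by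
  have := integral_mul_exp_of_hasSum hh (F := F) (c := c) (y := 1)
    (fun x => H _ (by simp)) 0 m
  simp only [zero_add, Complex.ofReal_one, one_mul] at this
  rw [VW.fourierCoefficient, this]
  have hh' : (h : ℂ) ≠ 0 := by exact_mod_cast hh
  field_simp

/-! ### The q-expansion of the inverse discriminant -/

/-- The generating function `∏ (1 - q ^ n) ^ (-24)`. -/
noncomputable def eulerInv (q : ℂ) : ℂ := ((∏' n : ℕ, (1 - q ^ (n + 1))) ^ 24)⁻¹

theorem tprod_one_sub_pow_ne_zero {q : ℂ} (hq : ‖q‖ < 1) : ∏' n : ℕ, (1 - q ^ (n + 1)) ≠ 0 := by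
  have hs : Summable fun n : ℕ => ‖-q ^ (n + 1)‖ := by
    simpa using (summable_nat_add_iff 1).mpr (summable_geometric_of_lt_one (norm_nonneg _) hq)
  have := tprod_one_add_ne_zero_of_summable (f := fun n : ℕ => -q ^ (n + 1)) (fun n h => ?_) hs
  · simpa [sub_eq_add_neg] using this
  · have h1 : q ^ (n + 1) = 1 := by linear_combination -h
    have h2 : ‖q‖ ^ (n + 1) = 1 := by rw [← norm_pow, h1, norm_one]
    exact absurd h2 (pow_lt_one₀ (norm_nonneg _) hq (by simp)).ne

theorem differentiableOn_eulerInv : DifferentiableOn ℂ eulerInv (Metric.ball 0 1) :=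
  (ModularForm.differentiableOn_tprod_one_sub_pow.fun_pow 24).fun_inv fun _ hq =>
    pow_ne_zero _ (tprod_one_sub_pow_ne_zero (by simpa using hq))

theorem eulerInv_zero : eulerInv 0 = 1 := by simp [eulerInv]

theorem norm_exp_two_pi_I_mul (τ : ℂ) :
    ‖Complex.exp (2 * Real.pi * Complex.I * τ)‖ = Real.exp (-(2 * Real.pi * τ.im)) := by
  rw [Complex.norm_exp]; simp

theorem eta_zpow_eq {τ : ℂ} : ModularForm.eta τ ^ (-24 : ℤ) =
    Complex.exp (-(2 * Real.pi * Complex.I * τ)) * eulerInv (Complex.exp (2 * Real.pi * Complex.I * τ)) := by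
  have h1 : Function.Periodic.qParam 24 τ ^ 24 = Complex.exp (2 * Real.pi * Complex.I * τ) := by
    rw [Function.Periodic.qParam, ← Complex.exp_nat_mul]
    congr 1; push_cast; ring
  rw [show (-24 : ℤ) = -((24 : ℕ) : ℤ) by rfl, zpow_neg, zpow_natCast, ModularForm.eta, mul_pow,
    mul_inv, h1, eulerInv, Complex.exp_neg]
  simp only [ModularForm.eta_q_eq_pow]

/-- The Fourier coefficients of `η ^ (-24)`, read off from the Taylor series of `eulerInv`. -/
noncomputable def etaCoeff (n : ℤ) : ℂ :=
  if -1 ≤ n then ((n + 1).toNat.factorial : ℂ)⁻¹ * iteratedDeriv (n + 1).toNat eulerInv 0 else 0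

theorem hasSum_etaCoeff {τ : ℂ} (hτ : 0 < τ.im) :
    HasSum (fun n : ℤ => etaCoeff n * Complex.exp (2 * Real.pi * Complex.I * n * τ))
      (ModularForm.eta τ ^ (-24 : ℤ)) := by
  set q := Complex.exp (2 * Real.pi * Complex.I * τ) with hq
  have hq1 : q ∈ Metric.ball (0 : ℂ) 1 := by
    rw [mem_ball_zero_iff, hq, norm_exp_two_pi_I_mul, Real.exp_lt_one_iff]
    have := Real.pi_pos
    have : 0 < 2 * Real.pi * τ.im := by positivity
    linarith
  have h1 := (Complex.hasSum_taylorSeries_on_ball differentiableOn_eulerInv hq1).mul_left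
    (Complex.exp (-(2 * Real.pi * Complex.I * τ)))
  rw [← eta_zpow_eq] at h1
  -- The prefactor $q^{-1}$ shifts degrees: the Taylor coefficient of index $k$ belongs to
  -- $q^{k-1}$.
  have hinj : Function.Injective (fun k : ℕ => (k : ℤ) - 1) := fun a b h => by simpa using h
  rw [← hinj.hasSum_iff]
  · refine Eq.mpr (congrArg (HasSum · _) (funext fun k : ℕ => ?_)) h1
    have hk : ((k : ℤ) - 1 + 1).toNat = k := by simp
    simp only [Function.comp_apply, etaCoeff, hk, sub_zero, smul_eq_mul]
    rw [if_pos (by omega), hq, ← Complex.exp_nat_mul]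
    have : Complex.exp (2 * Real.pi * Complex.I * ((k : ℤ) - 1 : ℤ) * τ) =
        Complex.exp (-(2 * Real.pi * Complex.I * τ)) *
        Complex.exp (k * (2 * Real.pi * Complex.I * τ)) := by
      rw [← Complex.exp_add]; congr 1; push_cast; ring
    rw [this]; ring
  · intro n hn
    have : ¬ -1 ≤ n := fun h => hn ⟨(n + 1).toNat, by simp; omega⟩
    simp [etaCoeff, this]

theorem a_eq_etaCoeff (n : ℤ) : VW.a n = etaCoeff n :=
  fourierCoefficient_eq_of_hasSum one_ne_zero (fun τ hτ => by simpa using hasSum_etaCoeff hτ) n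

theorem hasSum_a {τ : ℂ} (hτ : 0 < τ.im) :
    HasSum (fun n : ℤ => VW.a n * Complex.exp (2 * Real.pi * Complex.I * n * τ))
      (ModularForm.eta τ ^ (-24 : ℤ)) := by
  simpa [a_eq_etaCoeff] using hasSum_etaCoeff hτ

/-- The Fourier coefficient of `η ^ (-24)` as an integral over `[-1/2, 1/2]` at any height. -/
theorem a_eq_integral (n : ℤ) {y : ℝ} (hy : 0 < y) :
    VW.a n = ∫ x in (-(1 / 2) : ℝ)..(1 / 2), ModularForm.eta (x + y * Complex.I) ^ (-24 : ℤ) *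
      Complex.exp (-(2 * Real.pi * Complex.I * n * (x + y * Complex.I))) := by
  have := integral_mul_exp_of_hasSum one_ne_zero (F := fun τ => ModularForm.eta τ ^ (-24 : ℤ))
    (c := VW.a) (y := y) (fun x => by
      have := hasSum_a (τ := x + y * Complex.I) (by simpa using hy)
      simpa using this) (-(1 / 2)) n
  norm_num at this
  rw [← this]; norm_num

/-! ### Root-of-unity filter and the coefficients of the partition function -/

/-- The sum of the `n`-th powers of the `p`-th roots of unity. -/
theorem sum_exp_int_mul {p : ℕ} (hp : p ≠ 0) (n : ℤ) :
    ∑ j ∈ Finset.range p, Complex.exp (2 * Real.pi * Complex.I * n * j / p) =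
      if (p : ℤ) ∣ n then (p : ℂ) else 0 := by
  have hp' : (p : ℂ) ≠ 0 := by exact_mod_cast hp
  have e : ∀ j : ℕ, Complex.exp (2 * Real.pi * Complex.I * n * j / p) =
      Complex.exp (2 * Real.pi * Complex.I * n / p) ^ j := by
    intro j
    rw [← Complex.exp_nat_mul]; congr 1; ring
  simp_rw [e]
  split_ifs with h
  · obtain ⟨l, rfl⟩ := h
    have : Complex.exp (2 * Real.pi * Complex.I * ((p : ℤ) * l : ℤ) / p) = 1 := by
      rw [Complex.exp_eq_one_iff]
      exact ⟨l, by push_cast; field_simp⟩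
    simp_rw [this]; simp
  · have h1 : Complex.exp (2 * Real.pi * Complex.I * n / p) ≠ 1 := by
      intro h1
      obtain ⟨l, hl⟩ := Complex.exp_eq_one_iff.mp h1
      apply h
      refine ⟨l, ?_⟩
      have hc : (2 * Real.pi * Complex.I : ℂ) ≠ 0 := Complex.two_pi_I_ne_zero
      have : (2 * Real.pi * Complex.I : ℂ) * n = (2 * Real.pi * Complex.I) * (p * l) := by
        field_simp at hl
        linear_combination (2 * Real.pi * Complex.I) * hl
      exact_mod_cast mul_left_cancel₀ hc this
    rw [geom_sum_eq h1, ← e p]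
    have : Complex.exp (2 * Real.pi * Complex.I * n * p / p) = 1 := by
      rw [Complex.exp_eq_one_iff]
      exact ⟨n, by field_simp⟩
    simp [this]

section Partition

variable {S : Type*} [TopologicalSpace S]

/-- The coefficient of `q ^ (k / p)` in `Z_w(q)`, when `2 p ∣ w²`. -/
noncomputable def partitionCoeff (p : ℕ) (w : VW.H S 2) (k : ℤ) : ℂ :=
  VW.delta p w 0 / (p : ℂ) ^ 2 * (if (p : ℤ) ^ 2 ∣ k then VW.a (k / (p : ℤ) ^ 2) else 0) +
    if (p : ℤ) ∣ k then VW.a k else 0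

/-- Since $q^p = (q^{1/p})^{p^2}$, the expansion at $p\tau$ is supported on multiples of $p^2$. -/
theorem hasSum_eta_mul {p : ℕ} (hp : p ≠ 0) {τ : ℂ} (hτ : 0 < τ.im) :
    HasSum (fun k : ℤ => (if (p : ℤ) ^ 2 ∣ k then VW.a (k / (p : ℤ) ^ 2) else 0) *
      Complex.exp (2 * Real.pi * Complex.I * k * τ / p)) (ModularForm.eta (p * τ) ^ (-24 : ℤ)) := by
  have hp' : (p : ℂ) ≠ 0 := by exact_mod_cast hp
  have hpz : (p : ℤ) ^ 2 ≠ 0 := by positivity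
  have him : 0 < ((p : ℂ) * τ).im := by
    have : 0 < (p : ℝ) := by positivity
    simpa using mul_pos this hτ
  have h1 := hasSum_a him
  have hinj : Function.Injective (fun k : ℤ => (p : ℤ) ^ 2 * k) := mul_right_injective₀ hpz
  rw [← hinj.hasSum_iff]
  · refine Eq.mpr (congrArg (HasSum · _) (funext fun k : ℤ => ?_)) h1
    simp only [Function.comp_apply, dvd_mul_right, if_true, Int.mul_ediv_cancel_left _ hpz]
    congr 2; push_cast; field_simp
  · intro k hk
    have : ¬ (p : ℤ) ^ 2 ∣ k := fun ⟨l, hl⟩ => hk ⟨l, hl.symm⟩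
    simp [this]

/-- Replacing $\tau$ by $\tau + j$ twists the $k$-th term by $e^{2\pi i k j/p}$; averaging over $j$
kills it unless $p \mid k$. -/
theorem hasSum_sum_eta_div {p : ℕ} (hp : p ≠ 0) {τ : ℂ} (hτ : 0 < τ.im) :
    HasSum (fun k : ℤ => (if (p : ℤ) ∣ k then VW.a k else 0) *
      Complex.exp (2 * Real.pi * Complex.I * k * τ / p))
      (1 / (p : ℂ) * ∑ j ∈ Finset.range p, ModularForm.eta ((τ + j) / p) ^ (-24 : ℤ)) := by
  have hp' : (p : ℂ) ≠ 0 := by exact_mod_cast hp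
  have hpr : 0 < (p : ℝ) := by positivity
  have h1 : ∀ j : ℕ, HasSum (fun n : ℤ => VW.a n *
      Complex.exp (2 * Real.pi * Complex.I * n * ((τ + j) / p)))
      (ModularForm.eta ((τ + j) / p) ^ (-24 : ℤ)) := by
    intro j
    refine hasSum_a ?_
    have : ((τ + j) / p).im = τ.im / p := by
      rw [Complex.div_natCast_im]; simp
    rw [this]; positivity
  have h2 := (hasSum_sum fun j (_ : j ∈ Finset.range p) => h1 j).mul_left (1 / (p : ℂ))
  refine Eq.mpr (congrArg (HasSum · _) (funext fun k : ℤ => ?_)) h2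
  have e : ∀ j : ℕ, VW.a k * Complex.exp (2 * Real.pi * Complex.I * k * ((τ + j) / p)) =
      VW.a k * Complex.exp (2 * Real.pi * Complex.I * k * τ / p) *
        Complex.exp (2 * Real.pi * Complex.I * k * j / p) := by
    intro j
    rw [mul_assoc (VW.a k), ← Complex.exp_add]; congr 2; ring
  simp only [e]
  rw [← Finset.mul_sum, sum_exp_int_mul hp]
  split_ifs
  · field_simp
  · simp

/-- With $w^2 = 2pl$ the phase is $e^{-2\pi i j l} = 1$. This is the only place where the hypothesis
on $w^2$ acts directly. -/
theorem Z_eq {p : ℕ} (hp : p ≠ 0) {deg : VW.H S 4 ≃+ ℤ} {w : VW.H S 2} {m : ℤ}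
    (hm : VW.selfIntersection deg w = 2 * m) (hpm : (p : ℤ) ∣ m) (τ : ℂ) :
    VW.Z p deg w τ = VW.delta p w 0 / (p : ℂ) ^ 2 * ModularForm.eta (p * τ) ^ (-24 : ℤ) +
      1 / (p : ℂ) * ∑ j ∈ Finset.range p, ModularForm.eta ((τ + j) / p) ^ (-24 : ℤ) := by
  have hp' : (p : ℂ) ≠ 0 := by exact_mod_cast hp
  obtain ⟨l, rfl⟩ := hpm
  have : ∀ j : ℕ, Complex.exp (-(Real.pi * Complex.I * j * (VW.selfIntersection deg w : ℂ) / p)) =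
      1 := by
    intro j
    rw [hm, Complex.exp_eq_one_iff]
    exact ⟨-(j * l), by push_cast; field_simp⟩
  simp only [VW.Z, this, one_mul]

theorem hasSum_Z {p : ℕ} (hp : p ≠ 0) {deg : VW.H S 4 ≃+ ℤ} {w : VW.H S 2} {m : ℤ}
    (hm : VW.selfIntersection deg w = 2 * m) (hpm : (p : ℤ) ∣ m) {τ : ℂ} (hτ : 0 < τ.im) :
    HasSum (fun k : ℤ => partitionCoeff p w k *
      Complex.exp (2 * Real.pi * Complex.I * k * τ / p)) (VW.Z p deg w τ) := by
  rw [Z_eq hp hm hpm]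
  refine Eq.mpr (congrArg (HasSum · _) (funext fun k : ℤ => ?_))
    (((hasSum_eta_mul hp hτ).mul_left _).add (hasSum_sum_eta_div hp hτ))
  rw [partitionCoeff, add_mul, mul_assoc]

theorem alpha2_eq {p : ℕ} (hp : p ≠ 0) {deg : VW.H S 4 ≃+ ℤ} {w : VW.H S 2} {m : ℤ}
    (hm : VW.selfIntersection deg w = 2 * m) (hpm : (p : ℤ) ∣ m) (k : ℤ) :
    VW.alpha2 p deg w k = partitionCoeff p w k :=
  fourierCoefficient_eq_of_hasSum hp (fun _ hτ => hasSum_Z hp hm hpm hτ) k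

theorem partitionCoeff_of_not_dvd {p : ℕ} (w : VW.H S 2) {k : ℤ} (hk : ¬ (p : ℤ) ∣ k) :
    partitionCoeff p w k = 0 := by
  have : ¬ (p : ℤ) ^ 2 ∣ k := fun h => hk ((dvd_pow_self _ two_ne_zero).trans h)
  simp [partitionCoeff, hk, this]

theorem partitionCoeff_mul {p : ℕ} (hp : p ≠ 0) (w : VW.H S 2) (n : ℤ) :
    partitionCoeff p w (p * n) = VW.a (p * n) +
      if (p : ℤ) ∣ n then VW.delta p w 0 / (p : ℂ) ^ 2 * VW.a (n / p) else 0 := by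
  have hpz : (p : ℤ) ≠ 0 := by exact_mod_cast hp
  rw [partitionCoeff, if_pos (dvd_mul_right _ _), sq (p : ℤ),
    Int.mul_ediv_mul_of_pos _ _ (by positivity), add_comm]
  simp only [mul_dvd_mul_iff_left hpz]
  split_ifs <;> simp

theorem hasSum_alpha2' {p : ℕ} (hp : p ≠ 0) {deg : VW.H S 4 ≃+ ℤ} {w : VW.H S 2} {m : ℤ}
    (hm : VW.selfIntersection deg w = 2 * m) (hpm : (p : ℤ) ∣ m) {τ : ℂ} (hτ : 0 < τ.im) :
    HasSum (fun n : ℤ => VW.alpha2' p deg w n * Complex.exp (2 * Real.pi * Complex.I * n * τ))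
      (VW.Z p deg w τ) := by
  have hp' : (p : ℂ) ≠ 0 := by exact_mod_cast hp
  have hpz : (p : ℤ) ≠ 0 := by exact_mod_cast hp
  have h1 := hasSum_Z hp hm hpm hτ
  rw [← (mul_right_injective₀ hpz).hasSum_iff] at h1
  · refine Eq.mpr (congrArg (HasSum · _) (funext fun k : ℤ => ?_)) h1
    simp only [Function.comp_apply, VW.alpha2', alpha2_eq hp hm hpm]
    congr 2; push_cast; field_simp
  · intro k hk
    rw [partitionCoeff_of_not_dvd w fun ⟨l, hl⟩ => hk ⟨l, hl.symm⟩, zero_mul]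

end Partition

/-! ### Size of the inverse discriminant near the real line -/

-- Inverse of the weight $12$ invariance of $\Delta = \eta^{24}$, which passes from the generators
-- $S$, $T$ to all of $SL_2(\mathbb Z)$.
open UpperHalfPlane in
open scoped MatrixGroups in
theorem eta_zpow_smul (γ : SL(2, ℤ)) (τ : ℍ) :
    ModularForm.eta τ ^ (-24 : ℤ) =
      denom γ τ ^ 12 * ModularForm.eta ((γ • τ : ℍ) : ℂ) ^ (-24 : ℤ) := by
  have h := congrFun (SlashInvariantForm.slash_action_generators_SL2Z
    ModularForm.discriminant_S_invariant ModularForm.discriminant_T_invariant γ) τ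
  rw [ModularForm.SL_slash_apply] at h
  have hd : denom γ τ ≠ 0 := denom_ne_zero _ _
  simp only [ModularForm.discriminant] at h
  have e : ∀ z : ℂ, ModularForm.eta z ^ (-24 : ℤ) = (ModularForm.eta z ^ 24)⁻¹ := fun z => by
    rw [show (-24 : ℤ) = -((24 : ℕ) : ℤ) by rfl, zpow_neg, zpow_natCast]
  rw [e, e, ← h, mul_inv, zpow_neg, inv_inv, mul_comm]
  norm_cast

/-- `η ^ (-24)` differs from its polar part by a bounded function near the cusp. -/
theorem exists_norm_eta_zpow_sub_le : ∃ C : ℝ, 0 < C ∧ ∀ τ : ℂ, 1 / 2 ≤ τ.im →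
    ‖ModularForm.eta τ ^ (-24 : ℤ) - Complex.exp (-(2 * Real.pi * Complex.I * τ))‖ ≤ C := by
  have hr : Real.exp (-Real.pi) < 1 := by
    rw [Real.exp_lt_one_iff]; linarith [Real.pi_pos]
  -- With $E$ denoting `eulerInv`, the quantity to bound is $(E(q) - E(0))/q$, whose singularity at
  -- $q = 0$ is removable; $\operatorname{Im}\tau \ge 1/2$ means $|q| \le e^{-\pi}$.
  have hc : ContinuousOn (dslope eulerInv 0) (Metric.closedBall 0 (Real.exp (-Real.pi))) := by
    have hb : Metric.ball (0 : ℂ) 1 ∈ 𝓝 0 := Metric.ball_mem_nhds _ one_pos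
    exact ((continuousOn_dslope hb).mpr ⟨differentiableOn_eulerInv.continuousOn,
      differentiableOn_eulerInv.differentiableAt hb⟩).mono
      (Metric.closedBall_subset_ball hr)
  obtain ⟨C, hC⟩ := (isCompact_closedBall _ _).exists_bound_of_continuousOn hc
  refine ⟨max C 1, by positivity, fun τ hτ => le_max_of_le_left ?_⟩
  have hq : Complex.exp (2 * Real.pi * Complex.I * τ) ∈
      Metric.closedBall (0 : ℂ) (Real.exp (-Real.pi)) := by
    rw [mem_closedBall_zero_iff, norm_exp_two_pi_I_mul, Real.exp_le_exp]
    nlinarith [Real.pi_pos]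
  have := hC _ hq
  rwa [dslope_of_ne _ (Complex.exp_ne_zero _), slope_def_field, sub_zero, eulerInv_zero,
    div_eq_mul_inv, ← Complex.exp_neg, sub_mul, one_mul, mul_comm, ← eta_zpow_eq] at this

theorem norm_exp_neg_two_pi_I_mul (τ : ℂ) :
    ‖Complex.exp (-(2 * Real.pi * Complex.I * τ))‖ = Real.exp (2 * Real.pi * τ.im) := by
  rw [Complex.norm_exp]; simp

/-- Near the cusps `c/d` with `|c| = 2`, the size of the polar part is governed by a Gaussian. -/
theorem near_half_bound {t y : ℝ} (hy : 0 < y) (ht : |t| ≤ y) :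
    (4 * (t ^ 2 + y ^ 2)) ^ 6 * Real.exp (2 * Real.pi * (y / (4 * (t ^ 2 + y ^ 2)))) ≤
      8 ^ 6 * (y ^ 12 * Real.exp (Real.pi / (2 * y) - Real.pi * t ^ 2 / (4 * y ^ 3))) := by
  have ht2 : t ^ 2 ≤ y ^ 2 := sq_le_sq' (by linarith [neg_abs_le t]) (by linarith [le_abs_self t])
  have h1 : (4 * (t ^ 2 + y ^ 2)) ^ 6 ≤ 8 ^ 6 * y ^ 12 := by
    calc (4 * (t ^ 2 + y ^ 2)) ^ 6 ≤ (8 * y ^ 2) ^ 6 := by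
          apply pow_le_pow_left₀ (by positivity); linarith
      _ = _ := by ring
  -- With $s = t^2/y^2 \le 1$ this is $1/(1+s) \le 1 - s/2$, divided by $4y$.
  have h2 : y / (4 * (t ^ 2 + y ^ 2)) ≤ 1 / (4 * y) - t ^ 2 / (8 * y ^ 3) := by
    have : 1 / (4 * y) - t ^ 2 / (8 * y ^ 3) = (2 * y ^ 2 - t ^ 2) / (8 * y ^ 3) := by
      field_simp; ring
    rw [this, div_le_div_iff₀ (by positivity) (by positivity)]
    nlinarith [mul_nonneg (sq_nonneg t) (sub_nonneg.mpr ht2)]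
  calc _ ≤ (8 ^ 6 * y ^ 12) * Real.exp (2 * Real.pi * (1 / (4 * y) - t ^ 2 / (8 * y ^ 3))) := by
        gcongr
    _ = _ := by
        rw [mul_assoc]; congr 3; field_simp; ring

/-- The dominant part of the error near the cusps `±1/2`. -/
noncomputable def halfGaussian (y t : ℝ) : ℝ :=
  y ^ 12 * Real.exp (Real.pi / (2 * y) - Real.pi * t ^ 2 / (4 * y ^ 3))

theorem halfGaussian_nonneg {y : ℝ} (hy : 0 < y) (t : ℝ) : 0 ≤ halfGaussian y t := by
  unfold halfGaussian; positivity

set_option maxHeartbeats 1000000 in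
open UpperHalfPlane in
open scoped MatrixGroups in
/-- Away from the cusp `0`, the polar part at the nearest cusp is small. -/
theorem norm_denom_pow_mul_exp_le {τ : ℍ} (hx : |τ.re| ≤ 1 / 2) (hy : τ.im ≤ 1 / 20)
    (h0 : τ.im < 1 / 2 * Complex.normSq τ) (γ : SL(2, ℤ)) (hγ : 1 / 2 ≤ (γ • τ).im)
    (hd : ‖denom γ τ‖ ≤ 1) :
    ‖denom γ τ‖ ^ 12 * Real.exp (2 * Real.pi * (γ • τ).im) ≤
      8 ^ 6 * (Real.exp (Real.pi / (4 * τ.im)) + (halfGaussian τ.im (τ.re - 1 / 2) +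
        halfGaussian τ.im (τ.re + 1 / 2))) := by
  have hy0 := τ.im_pos
  set y := τ.im with hydef
  set x := τ.re with hxdef
  set c : ℤ := γ 1 0 with hc
  set d : ℤ := γ 1 1 with hdd
  have hg1 := halfGaussian_nonneg hy0 (x - 1 / 2)
  have hg2 := halfGaussian_nonneg hy0 (x + 1 / 2)
  have hden : Complex.normSq (denom γ τ) = (c * x + d) ^ 2 + (c * y) ^ 2 := by
    rw [ModularGroup.denom_apply, Complex.normSq_apply]
    simp [← hc, ← hdd]; ring
  have him : (γ • τ).im = y / ((c * x + d) ^ 2 + (c * y) ^ 2) := by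
    rw [ModularGroup.im_smul_eq_div_normSq, hden]
  have hpos : 0 < (c * x + d) ^ 2 + (c * y) ^ 2 := by
    rw [← hden]; exact Complex.normSq_pos.mpr (denom_ne_zero _ _)
  have hle : (c * x + d) ^ 2 + (c * y) ^ 2 ≤ 2 * y := by
    rw [him, le_div_iff₀ hpos] at hγ; linarith
  have hn12 : ‖denom γ τ‖ ^ 12 = ((c * x + d) ^ 2 + (c * y) ^ 2) ^ 6 := by
    rw [← hden, Complex.normSq_eq_norm_sq]; ring
  -- The threshold $1/(8y)$ is met both when $|c| \ge 3$, where the height is at most $1/(9y)$, and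
  -- when $|c| = 2$ but $\tau$ is horizontally at least $y$ away from the cusp.
  have hsmall : (γ • τ).im ≤ 1 / (8 * y) → ‖denom γ τ‖ ^ 12 * Real.exp (2 * Real.pi * (γ • τ).im) ≤
      8 ^ 6 * (Real.exp (Real.pi / (4 * y)) + (halfGaussian y (x - 1 / 2) +
        halfGaussian y (x + 1 / 2))) := by
    intro h
    have h1 : ‖denom γ τ‖ ^ 12 ≤ 1 := pow_le_one₀ (norm_nonneg _) hd
    have h2 : Real.exp (2 * Real.pi * (γ • τ).im) ≤ Real.exp (Real.pi / (4 * y)) := by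
      rw [Real.exp_le_exp]
      calc _ ≤ 2 * Real.pi * (1 / (8 * y)) := by gcongr
        _ = _ := by field_simp; ring
    have h3 := mul_le_mul h1 h2 (Real.exp_nonneg _) zero_le_one
    nlinarith [Real.exp_nonneg (Real.pi / (4 * y))]
  -- The bound $y \le 1/20$ is used here: $(cx+d)^2 \le 2y \le 1/10 < 1/9$.
  have hcd : |c * x + d| < 1 / 3 := by
    apply abs_lt_of_sq_lt_sq _ (by norm_num)
    nlinarith [sq_nonneg (c * y)]
  obtain ⟨hcd1, hcd2⟩ := abs_lt.mp hcd
  obtain ⟨hx1, hx2⟩ := abs_le.mp hx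
  have hdet : γ 0 0 * d - γ 0 1 * c = 1 := by
    have := γ.det_coe
    rw [Matrix.det_fin_two] at this
    exact this
  rcases lt_or_ge 2 |c| with h3 | h3
  · apply hsmall
    rw [him, div_le_div_iff₀ hpos (by positivity)]
    have : (9 : ℝ) ≤ (c : ℝ) ^ 2 := by
      have : (3 : ℤ) ^ 2 ≤ c ^ 2 := by
        rw [sq_le_sq, abs_of_pos (by norm_num : (0 : ℤ) < 3)]; omega
      exact_mod_cast this
    nlinarith [sq_nonneg (c * x + d), mul_le_mul_of_nonneg_right this (sq_nonneg y)]
  have key : ∀ s : ℝ, (c * x + d) ^ 2 + (c * y) ^ 2 = 4 * ((x - s) ^ 2 + y ^ 2) →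
      halfGaussian y (x - s) ≤ halfGaussian y (x - 1 / 2) + halfGaussian y (x + 1 / 2) →
      ‖denom γ τ‖ ^ 12 * Real.exp (2 * Real.pi * (γ • τ).im) ≤
      8 ^ 6 * (Real.exp (Real.pi / (4 * y)) + (halfGaussian y (x - 1 / 2) +
        halfGaussian y (x + 1 / 2))) := by
    intro s hs hg
    rcases le_total |x - s| y with h | h
    · have := near_half_bound hy0 h
      rw [hn12, him, hs]
      have h4 := Real.exp_nonneg (Real.pi / (4 * y))
      refine this.trans (mul_le_mul_of_nonneg_left ?_ (by norm_num))
      rw [halfGaussian] at hg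
      linarith
    · apply hsmall
      rw [him, hs, div_le_div_iff₀ (by rw [← hs]; exact hpos) (by positivity)]
      have := sq_le_sq' (by linarith) h
      rw [sq_abs] at this
      nlinarith
  have hclo := (abs_le.mp h3).1
  have hchi := (abs_le.mp h3).2
  have hc5 : c = -2 ∨ c = -1 ∨ c = 0 ∨ c = 1 ∨ c = 2 := by omega
  have hdb1 : (-2 : ℝ) < d := by
    rcases hc5 with h | h | h | h | h <;> rw [h] at hcd1 hcd2 <;> push_cast at hcd1 hcd2 <;> linarith
  have hdb2 : (d : ℝ) < 2 := by
    rcases hc5 with h | h | h | h | h <;> rw [h] at hcd1 hcd2 <;> push_cast at hcd1 hcd2 <;> linarith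
  have hdb1' : -2 < d := by exact_mod_cast hdb1
  have hdb2' : d < 2 := by exact_mod_cast hdb2
  have hd3 : d = -1 ∨ d = 0 ∨ d = 1 := by omega
  have e1 : halfGaussian y (x - -(1 / 2)) ≤
    halfGaussian y (x - 1 / 2) + halfGaussian y (x + 1 / 2) := by
    rw [sub_neg_eq_add]; linarith
  have e2 : halfGaussian y (x - 1 / 2) ≤
    halfGaussian y (x - 1 / 2) + halfGaussian y (x + 1 / 2) := by linarith
  rw [Complex.normSq_apply] at h0
  change y < 1 / 2 * (x * x + y * y) at h0
  -- Only $c = \pm 2$, $d = \pm 1$ survive. The determinant excludes $d = 0$ with $c$ even, the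
  -- hypothesis `h0` excludes the cusp $0$ ($c = \pm 1$, $d = 0$), and $|cx+d| < 1/3$ with $|x| \le
  -- 1/2$ excludes the rest.
  rcases hc5 with h | h | h | h | h <;> rcases hd3 with h' | h' | h' <;>
    rw [h, h'] at hcd1 hcd2 hle key hdet <;> push_cast at hcd1 hcd2 hle <;>
    first
    | (exfalso; omega)
    | (exfalso; linarith)
    | exact key (1 / 2) (by simp only [Int.cast_ofNat, Int.cast_one, Int.cast_neg]; ring1) e2
    | exact key (-(1 / 2)) (by simp only [Int.cast_ofNat, Int.cast_one, Int.cast_neg]; ring1) e1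

open UpperHalfPlane in
open scoped MatrixGroups in
/-- Approximation of `η ^ (-24)` by its polar part at the cusp `0`, up to the contribution of the
cusps `±1/2`. -/
theorem exists_norm_eta_zpow_sub_polar_le : ∃ C : ℝ, 0 < C ∧ ∀ x y : ℝ, |x| ≤ 1 / 2 → 0 < y →
    y ≤ 1 / 20 →
    ‖ModularForm.eta (x + y * Complex.I) ^ (-24 : ℤ) - (x + y * Complex.I) ^ 12 *
      Complex.exp (2 * Real.pi * Complex.I / (x + y * Complex.I))‖ ≤
    C * (Real.exp (Real.pi / (4 * y)) +
      (halfGaussian y (x - 1 / 2) + halfGaussian y (x + 1 / 2))) := by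
  obtain ⟨C, hC, hpol⟩ := exists_norm_eta_zpow_sub_le
  refine ⟨C + 8 ^ 6 * (1 + C) + Real.exp Real.pi, by positivity, fun x y hx hy0 hy => ?_⟩
  set R := Real.exp (Real.pi / (4 * y)) +
    (halfGaussian y (x - 1 / 2) + halfGaussian y (x + 1 / 2)) with hR
  have hR1 : 1 ≤ R := by
    have h1 : 1 ≤ Real.exp (Real.pi / (4 * y)) := Real.one_le_exp (by positivity)
    linarith [halfGaussian_nonneg hy0 (x - 1 / 2), halfGaussian_nonneg hy0 (x + 1 / 2)]
  let τ : ℍ := ⟨x + y * Complex.I, by simpa using hy0⟩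
  have hτ : (x + y * Complex.I : ℂ) = (τ : ℂ) := rfl
  have hre : τ.re = x := by simp [τ, UpperHalfPlane.re]
  have him : τ.im = y := by simp [τ, UpperHalfPlane.im]
  rw [hτ]
  have hnormsq : Complex.normSq τ = x ^ 2 + y ^ 2 := by
    rw [Complex.normSq_apply]
    change τ.re * τ.re + τ.im * τ.im = _
    rw [hre, him]; ring
  have hpos : 0 < Complex.normSq τ := Complex.normSq_pos.mpr τ.ne_zero
  have hn1 : ‖(τ : ℂ)‖ ^ 12 ≤ 1 := by
    have : ‖(τ : ℂ)‖ ^ 12 = Complex.normSq τ ^ 6 := by rw [Complex.normSq_eq_norm_sq]; ring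
    rw [this]
    apply pow_le_one₀ hpos.le
    rw [hnormsq]
    nlinarith [abs_le.mp hx]
  have hS : ((ModularGroup.S • τ : ℍ) : ℂ) = -(1 / (τ : ℂ)) := by
    rw [UpperHalfPlane.modular_S_smul]; simp
  have hSim : (ModularGroup.S • τ : ℍ).im = y / Complex.normSq τ := by
    rw [ModularGroup.im_smul_eq_div_normSq, ModularGroup.denom_S, him]
  have hSexp : Complex.exp (-(2 * Real.pi * Complex.I * ((ModularGroup.S • τ : ℍ) : ℂ))) =
      Complex.exp (2 * Real.pi * Complex.I / τ) := by
    rw [hS]; congr 1; ring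
  -- Either $-1/\tau$ has height at least $1/2$, and the polar part at $0$ approximates
  -- $\eta^{-24}$; or that polar part is itself bounded by $e^\pi$, and $\eta^{-24}$ is estimated at
  -- another cusp.
  rcases le_or_gt (1 / 2 * Complex.normSq τ) y with h | h
  · have h1 := hpol (ModularGroup.S • τ : ℍ) (by
      change 1 / 2 ≤ (ModularGroup.S • τ : ℍ).im
      rw [hSim, le_div_iff₀ hpos]; exact h)
    rw [hSexp] at h1
    rw [eta_zpow_smul ModularGroup.S τ, ModularGroup.denom_S, ← mul_sub, norm_mul, norm_pow]
    calc _ ≤ 1 * C := by gcongr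
      _ ≤ C * R := by nlinarith
      _ ≤ _ := by
        apply mul_le_mul_of_nonneg_right _ (by linarith)
        nlinarith [Real.exp_pos Real.pi]
  · obtain ⟨γ, hγ, hd⟩ := ModularGroup.exists_one_half_le_im_smul_and_norm_denom_le τ
    have hmain := norm_denom_pow_mul_exp_le (by rw [hre]; exact hx) (by rw [him]; exact hy)
      (by rw [him]; exact h) γ hγ hd
    rw [hre, him] at hmain
    have hpolar : ‖(τ : ℂ) ^ 12 * Complex.exp (2 * Real.pi * Complex.I / τ)‖ ≤
        Real.exp Real.pi := by
      rw [norm_mul, norm_pow, ← hSexp, norm_exp_neg_two_pi_I_mul]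
      have : 2 * Real.pi * ((ModularGroup.S • τ : ℍ) : ℂ).im ≤ Real.pi := by
        change 2 * Real.pi * (ModularGroup.S • τ : ℍ).im ≤ Real.pi
        have : (ModularGroup.S • τ : ℍ).im ≤ 1 / 2 := by
          rw [hSim, div_le_iff₀ hpos]; exact h.le
        nlinarith [Real.pi_pos]
      calc _ ≤ 1 * Real.exp Real.pi := by gcongr
        _ = _ := one_mul _
    have hF : ‖ModularForm.eta τ ^ (-24 : ℤ)‖ ≤ (1 + C) *
        (‖denom γ τ‖ ^ 12 * Real.exp (2 * Real.pi * (γ • τ).im)) := by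
      rw [eta_zpow_smul γ τ, norm_mul, norm_pow]
      have h1 := hpol (γ • τ : ℍ) hγ
      have h2 := norm_le_norm_add_norm_sub' (ModularForm.eta ((γ • τ : ℍ) : ℂ) ^ (-24 : ℤ))
        (Complex.exp (-(2 * Real.pi * Complex.I * ((γ • τ : ℍ) : ℂ))))
      rw [norm_exp_neg_two_pi_I_mul] at h2
      change _ ≤ Real.exp (2 * Real.pi * (γ • τ).im) + _ at h2
      have h3 : 1 ≤ Real.exp (2 * Real.pi * (γ • τ).im) :=
        Real.one_le_exp (by have := (γ • τ).im_pos; positivity)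
      calc _ ≤ ‖denom γ τ‖ ^ 12 * ((1 + C) * Real.exp (2 * Real.pi * (γ • τ).im)) := by
            gcongr; nlinarith
        _ = _ := by ring
    calc _ ≤ _ := norm_sub_le _ _
      _ ≤ (1 + C) * (8 ^ 6 * R) + Real.exp Real.pi * R := by
          refine add_le_add (hF.trans ?_) (hpolar.trans ?_)
          · gcongr
          · exact le_mul_of_one_le_right (Real.exp_nonneg _) hR1
      _ ≤ _ := by nlinarith

/-! ### The polar integrand and the Bessel series -/

open Complex in
theorem integral_exp_int_mul_I (m : ℤ) : ∫ θ in (0 : ℝ)..(2 * Real.pi), exp ((m : ℂ) * I * θ) =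
    if m = 0 then (2 * Real.pi : ℂ) else 0 := by
  split_ifs with hm
  · simp [hm]
  · have hm' : (m : ℂ) * I ≠ 0 := mul_ne_zero (by exact_mod_cast hm) I_ne_zero
    rw [integral_exp_mul_complex hm']
    have : exp ((m : ℂ) * I * (2 * Real.pi : ℝ)) = 1 := by
      rw [exp_eq_one_iff]; exact ⟨m, by push_cast; ring⟩
    rw [this]; simp

open Complex in
theorem circle_monomial_eq (α β u : ℂ) (ν k j : ℕ) (θ : ℝ) :
    (α / (u * exp (θ * I))) ^ k / k.factorial * ((β * (u * exp (θ * I))) ^ j / j.factorial) *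
      (u * exp (θ * I)) ^ ν =
    α ^ k * β ^ j / (k.factorial * j.factorial) * (u ^ (j + ν) / u ^ k) *
      exp (((j + ν - k : ℤ) : ℂ) * I * θ) := by
  have : exp (((j + ν - k : ℤ) : ℂ) * I * θ) = exp (θ * I) ^ (j + ν) / exp (θ * I) ^ k := by
    rw [← exp_nat_mul, ← exp_nat_mul, ← exp_sub]; congr 1; push_cast; ring
  rw [this, div_pow, mul_pow, mul_pow, mul_pow, pow_add, pow_add]
  generalize exp (θ * I) = v
  ring

theorem hasSum_prod_mul_of_summable_norm {f g : ℕ → ℂ} {a b : ℂ} (hf : HasSum f a)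
    (hg : HasSum g b) (hf' : Summable (‖f ·‖)) (hg' : Summable (‖g ·‖)) :
    HasSum (fun x : ℕ × ℕ => f x.1 * g x.2) (a * b) :=
  hf.mul hg (summable_mul_of_summable_norm hf' hg')

open Complex in
theorem hasSum_exp_div_mul_exp_mul (α β v : ℂ) :
    HasSum (fun x : ℕ × ℕ => (α / v) ^ x.1 / x.1.factorial * ((β * v) ^ x.2 / x.2.factorial))
      (exp (α / v) * exp (β * v)) := by
  have hexp : ∀ z : ℂ, HasSum (fun k : ℕ => z ^ k / k.factorial) (exp z) := fun z => by
    rw [exp_eq_exp_ℂ]; exact NormedSpace.expSeries_div_hasSum_exp z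
  exact hasSum_prod_mul_of_summable_norm (f := fun k : ℕ => (α / v) ^ k / k.factorial)
    (g := fun k : ℕ => (β * v) ^ k / k.factorial) (hexp _) (hexp _)
    (NormedSpace.norm_expSeries_div_summable _) (NormedSpace.norm_expSeries_div_summable _)

-- Termwise integration of the double exponential series. The domination is uniform in $\theta$
-- because $|e^{i\theta}| = 1$.
open Complex in
theorem hasSum_integral_circle (α β u : ℂ) (ν : ℕ) :
    HasSum (fun x : ℕ × ℕ => α ^ x.1 * β ^ x.2 / (x.1.factorial * x.2.factorial) *
      (u ^ (x.2 + ν) / u ^ x.1) * if (x.2 + ν - x.1 : ℤ) = 0 then (2 * Real.pi : ℂ) else 0)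
    (∫ θ in (0 : ℝ)..(2 * Real.pi), exp (α / (u * exp (θ * I))) * exp (β * (u * exp (θ * I))) *
      (u * exp (θ * I)) ^ ν) := by
  have hnorm : ∀ θ : ℝ, ‖exp (θ * I)‖ = 1 := fun θ => norm_exp_ofReal_mul_I θ
  have hs := intervalIntegral.hasSum_integral_of_dominated_convergence
    (μ := MeasureTheory.volume) (a := 0) (b := 2 * Real.pi)
    (F := fun (x : ℕ × ℕ) (θ : ℝ) => α ^ x.1 * β ^ x.2 / (x.1.factorial * x.2.factorial) *
      (u ^ (x.2 + ν) / u ^ x.1) * exp (((x.2 + ν - x.1 : ℤ) : ℂ) * I * θ))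
    (f := fun θ : ℝ => exp (α / (u * exp (θ * I))) * exp (β * (u * exp (θ * I))) *
      (u * exp (θ * I)) ^ ν)
    (fun x _ => ‖(α / u) ^ x.1 / x.1.factorial * ((β * u) ^ x.2 / x.2.factorial)‖ * ‖u ^ ν‖)
    (fun x => Continuous.aestronglyMeasurable (by fun_prop))
    (fun x => .of_forall fun θ _ => by
      rw [← circle_monomial_eq]
      simp [hnorm])
    (.of_forall fun θ _ => (hasSum_exp_div_mul_exp_mul α β u).summable.norm.mul_right _)
    intervalIntegrable_const
    (.of_forall fun θ _ => by
      simp only [← circle_monomial_eq]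
      exact (hasSum_exp_div_mul_exp_mul α β _).mul_right _)
  refine Eq.mpr (congrArg (HasSum · _) (funext fun x : ℕ × ℕ => ?_)) hs
  rw [intervalIntegral.integral_const_mul, integral_exp_int_mul_I]

open Complex in
/-- The constant term of `exp (α / u) exp (β u) u ^ ν` on a circle around the origin. -/
theorem integral_exp_div_mul_exp_mul_pow (α β u : ℂ) (hu : u ≠ 0) (ν : ℕ) :
    ∫ θ in (0 : ℝ)..(2 * Real.pi), exp (α / (u * exp (θ * I))) * exp (β * (u * exp (θ * I))) *
      (u * exp (θ * I)) ^ ν =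
    2 * Real.pi * ∑' j : ℕ, α ^ (ν + j) * β ^ j / ((ν + j).factorial * j.factorial) := by
  have hs := hasSum_integral_circle α β u ν
  have hinj : Function.Injective (fun j : ℕ => (ν + j, j)) := fun a b h => (Prod.ext_iff.mp h).2
  rw [← hinj.hasSum_iff] at hs
  · rw [← hs.tsum_eq, ← tsum_mul_left]
    refine tsum_congr fun j => ?_
    simp only [Function.comp_apply]
    rw [if_pos (by push_cast; ring), add_comm j ν, div_self (pow_ne_zero _ hu)]
    ring
  · rintro ⟨k, j⟩ hx
    rw [if_neg, mul_zero]
    intro h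
    simp only at h
    exact hx ⟨j, Prod.ext_iff.mpr ⟨by simp; omega, rfl⟩⟩

/-- The polar integrand `τ ^ 12 e ^ (2πi/τ) e ^ (-2πitτ)` at the cusp `0`. -/
noncomputable def polarIntegrand (t : ℝ) (τ : ℂ) : ℂ :=
  τ ^ 12 * Complex.exp (2 * Real.pi * Complex.I / τ) *
    Complex.exp (-(2 * Real.pi * Complex.I * t * τ))

/-- The leading term of the asymptotics of the coefficients of `η ^ (-24)`. -/
noncomputable def mainTerm (t : ℝ) : ℝ :=
  2 * Real.pi / t ^ (13 / 2 : ℝ) * VW.besselI 13 (4 * Real.pi * √t)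

theorem mainTerm_eq_tsum {t : ℝ} (ht : 0 < t) : mainTerm t = (2 * Real.pi) ^ 14 *
    ∑' j : ℕ, (4 * Real.pi ^ 2 * t) ^ j / ((13 + j).factorial * j.factorial) := by
  have h1 : t ^ (13 / 2 : ℝ) = √t ^ 13 := by
    rw [Real.sqrt_eq_rpow, ← Real.rpow_natCast, ← Real.rpow_mul ht.le]; norm_num
  have h2 : √t ≠ 0 := (Real.sqrt_pos.mpr ht).ne'
  rw [mainTerm, h1, VW.besselI, ← tsum_mul_left, ← tsum_mul_left]
  refine tsum_congr fun j => ?_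
  have h3 : (4 * Real.pi * √t / 2) ^ (2 * j + 13) =
      (4 * Real.pi ^ 2 * t) ^ j * (2 * Real.pi) ^ 13 * √t ^ 13 := by
    rw [pow_add, pow_mul, mul_assoc _ (_ ^ 13), ← mul_pow]
    congr 2
    · nth_rw 2 [← Real.sq_sqrt ht.le]; ring
    · ring
  rw [h3, add_comm j 13]
  field_simp

theorem norm_polarIntegrand_le {t : ℝ} (ht : 0 ≤ t) {y : ℝ} {τ : ℂ}
    (h1 : ‖τ‖ ≤ 1) (h2 : τ.im ≤ y) (h3 : τ.im / Complex.normSq τ ≤ 1 / 2) :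
    ‖polarIntegrand t τ‖ ≤ Real.exp Real.pi * Real.exp (2 * Real.pi * t * y) := by
  have e1 : ‖Complex.exp (2 * Real.pi * Complex.I / τ)‖ ≤ Real.exp Real.pi := by
    rw [Complex.norm_exp, Real.exp_le_exp]
    have : (2 * Real.pi * Complex.I / τ).re = 2 * Real.pi * (τ.im / Complex.normSq τ) := by
      rw [Complex.div_re]; simp; ring
    rw [this]
    nlinarith [Real.pi_pos]
  have e2 : ‖Complex.exp (-(2 * Real.pi * Complex.I * t * τ))‖ ≤
      Real.exp (2 * Real.pi * t * y) := by
    rw [Complex.norm_exp, Real.exp_le_exp]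
    have : (-(2 * Real.pi * Complex.I * t * τ)).re = 2 * Real.pi * t * τ.im := by simp
    rw [this]
    have := Real.pi_pos
    gcongr
  rw [polarIntegrand, norm_mul, norm_mul, norm_pow]
  calc _ ≤ 1 * Real.exp Real.pi * Real.exp (2 * Real.pi * t * y) := by
        gcongr
        exact pow_le_one₀ (norm_nonneg _) h1
    _ = _ := by ring

/-- The substitution $\tau = e^\zeta$ moves the essential singularity at $0$ to infinity. The
integrand becomes entire and has a global primitive, whose increment under a shift by $2\pi i$ plays
the role of the residue. -/
theorem differentiable_polarIntegrand_exp (t : ℝ) :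
    Differentiable ℂ fun ζ => polarIntegrand t (Complex.exp ζ) * Complex.exp ζ := by
  unfold polarIntegrand
  have : Differentiable ℂ fun ζ => 2 * Real.pi * Complex.I / Complex.exp ζ := by
    intro ζ
    exact (differentiableAt_const _).div Complex.differentiableAt_exp (Complex.exp_ne_zero _)
  fun_prop

open Complex in
/-- The period of a primitive of the polar integrand in the logarithmic coordinate. -/
theorem primitive_sub_eq_mainTerm {t : ℝ} (ht : 0 < t) {G : ℂ → ℂ}
    (hG : ∀ ζ, HasDerivAt G (polarIntegrand t (exp ζ) * exp ζ) ζ) (ζ : ℂ) :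
    G (ζ - 2 * Real.pi * I) - G ζ = mainTerm t := by
  -- Starting one period earlier makes the counterclockwise circle end at $\zeta$; hence the sign
  -- change below.
  set ξ := ζ - 2 * Real.pi * I
  have hd : ∀ θ : ℝ, HasDerivAt (fun θ : ℝ => G (ξ + θ * I))
      (polarIntegrand t (exp (ξ + θ * I)) * exp (ξ + θ * I) * I) θ := by
    intro θ
    have h1 : HasDerivAt (fun θ : ℝ => ξ + θ * I) (1 * I) θ :=
      ((hasDerivAt_id _).ofReal_comp.mul_const I).const_add ξ
    rw [one_mul] at h1
    exact (hG _).comp θ h1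
  have hcont : Continuous fun θ : ℝ =>
      polarIntegrand t (exp (ξ + θ * I)) * exp (ξ + θ * I) * I := by
    have := (differentiable_polarIntegrand_exp t).continuous
    exact (this.comp (by fun_prop : Continuous fun θ : ℝ => ξ + θ * I)).mul continuous_const
  have hi := intervalIntegral.integral_eq_sub_of_hasDerivAt (a := 0) (b := 2 * Real.pi)
    (fun θ _ => hd θ) (hcont.intervalIntegrable _ _)
  have e : ∀ θ : ℝ, polarIntegrand t (exp (ξ + θ * I)) * exp (ξ + θ * I) * I =
      exp (2 * Real.pi * I / (exp ξ * exp (θ * I))) *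
        exp (-(2 * Real.pi * I * t) * (exp ξ * exp (θ * I))) *
      (exp ξ * exp (θ * I)) ^ 13 * I := by
    intro θ
    rw [polarIntegrand, exp_add]; ring_nf
  simp only [e] at hi
  rw [intervalIntegral.integral_mul_const,
    integral_exp_div_mul_exp_mul_pow _ _ _ (exp_ne_zero _)] at hi
  have hζ : ξ + ((2 * Real.pi : ℝ) : ℂ) * I = ζ := by simp [ξ]
  rw [hζ, ofReal_zero, zero_mul, add_zero] at hi
  rw [← neg_sub, ← hi, mainTerm_eq_tsum ht]
  push_cast
  rw [mul_assoc, ← tsum_mul_right, ← neg_mul, ← tsum_mul_left, ← tsum_mul_left]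
  refine tsum_congr fun j => ?_
  have : (2 * Real.pi * I) ^ (13 + j) * (-(2 * Real.pi * I * t)) ^ j =
      (4 * Real.pi ^ 2 * t) ^ j * ((2 * Real.pi) ^ 13 * I) := by
    rw [pow_add, mul_assoc, ← mul_pow, mul_comm]
    congr 1
    · congr 1; linear_combination (-4 * Real.pi ^ 2 * t : ℂ) * I_sq
    · rw [mul_pow]; congr 1
      rw [show 13 = 4 * 3 + 1 by rfl, pow_succ, pow_mul, I_pow_four]; simp
  rw [this]
  linear_combination (-((2 * Real.pi) ^ 14 * (4 * Real.pi ^ 2 * t : ℂ) ^ j /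
    ((13 + j).factorial * j.factorial))) * I_sq

open Complex in
/-- Comparison of two branches of a primitive along a segment, in the logarithmic coordinate. -/
theorem norm_primitive_sub_le {t : ℝ} {G : ℂ → ℂ}
    (hG : ∀ ζ, HasDerivAt G (polarIntegrand t (exp ζ) * exp ζ) ζ) {a b : ℂ} {C : ℝ}
    (hslit : ∀ τ ∈ segment ℝ a b, I * τ ∈ slitPlane)
    (hC : ∀ τ ∈ segment ℝ a b, ‖polarIntegrand t τ‖ ≤ C) :
    ‖G (log (I * b) - Real.pi / 2 * I) - G (log (I * a) - Real.pi / 2 * I)‖ ≤ C * ‖b - a‖ := by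
  -- The map $\tau \mapsto \log(i\tau) - \pi i/2$ is a branch of the logarithm cut along the
  -- positive imaginary axis, so it is holomorphic on the lower sides of the rectangle.
  refine (convex_segment a b).norm_image_sub_le_of_norm_hasDerivWithin_le
    (f := fun τ => G (log (I * τ) - Real.pi / 2 * I)) (f' := polarIntegrand t) (fun τ hτ => ?_) hC
    (left_mem_segment ℝ a b) (right_mem_segment ℝ a b)
  have hs := hslit τ hτ
  have hne : I * τ ≠ 0 := slitPlane_ne_zero hs
  have hne' : τ ≠ 0 := right_ne_zero_of_mul hne
  have h1 : HasDerivAt (fun τ => log (I * τ) - Real.pi / 2 * I) (I * 1 / (I * τ)) τ :=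
    (((hasDerivAt_id τ).const_mul I).clog hs).sub_const _
  have h2 := (hG _).comp τ h1
  have h3 : exp (log (I * τ) - Real.pi / 2 * I) = τ := by
    rw [exp_sub, exp_log hne, exp_pi_div_two_mul_I, mul_div_cancel_left₀ _ I_ne_zero]
  rw [h3] at h2
  refine (h2.congr_deriv ?_).hasDerivWithinAt
  field_simp

open Complex in
/-- The integral of the polar integrand over the top side of the rectangle, by a primitive. -/
theorem integral_polarIntegrand_eq {t y : ℝ} (hy : 0 < y) {G : ℂ → ℂ}
    (hG : ∀ ζ, HasDerivAt G (polarIntegrand t (exp ζ) * exp ζ) ζ) :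
    ∫ x in (-(1 / 2) : ℝ)..(1 / 2), polarIntegrand t (x + y * I) =
      G (log ((1 / 2 : ℝ) + y * I)) - G (log ((-(1 / 2) : ℝ) + y * I)) := by
  have hs : ∀ x : ℝ, (x + y * I : ℂ) ∈ slitPlane := fun x => by
    rw [mem_slitPlane_iff]; right; simp [hy.ne']
  have hd : ∀ x : ℝ, HasDerivAt (fun x : ℝ => G (log (x + y * I)))
      (polarIntegrand t (x + y * I)) x := by
    intro x
    have h1 : HasDerivAt (fun x : ℝ => (x + y * I : ℂ)) 1 x :=
      (hasDerivAt_id _).ofReal_comp.add_const _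
    have h2 := (hG _).comp x (h1.clog_real (hs x))
    rw [exp_log (slitPlane_ne_zero (hs x))] at h2
    refine h2.congr_deriv ?_
    have := slitPlane_ne_zero (hs x)
    field_simp
  refine intervalIntegral.integral_eq_sub_of_hasDerivAt (fun x _ => hd x) ?_
  apply Continuous.intervalIntegrable
  unfold polarIntegrand
  have : Continuous fun x : ℝ => 2 * Real.pi * I / (x + y * I : ℂ) :=
    continuous_const.div (by fun_prop) fun x => slitPlane_ne_zero (hs x)
  fun_prop

open Complex in
theorem log_I_mul_of_re_pos {z : ℂ} (h1 : 0 < z.re) :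
    log (I * z) - Real.pi / 2 * I = log z := by
  have hz : z ≠ 0 := fun h => by simp [h] at h1
  have ha := (abs_arg_lt_pi_div_two_iff.mpr (Or.inl h1))
  have hb := abs_lt.mp ha
  rw [log_mul I_ne_zero hz, log_I]
  · ring
  · rw [arg_I]; constructor <;> linarith [Real.pi_pos]

-- The second quadrant lies across the rotated cut from the positive real axis, so the two branches
-- differ by $2\pi i$ there. This discrepancy produces the main term.
open Complex in
theorem log_I_mul_of_re_neg {z : ℂ} (h1 : z.re < 0) (h2 : 0 < z.im) :
    log (I * z) - Real.pi / 2 * I = log z - 2 * Real.pi * I := by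
  have h3 : z = I * (-I * z) := by rw [← mul_assoc]; simp
  have h4 := log_I_mul_of_re_pos (z := -I * z) (by simpa using h2)
  rw [← h3] at h4
  have h5 : I * z = -(-I * z) := by ring
  have h6 : log (-(-I * z)) = log (-I * z) - Real.pi * I := by
    rw [log, log, norm_neg, arg_neg_eq_arg_sub_pi_of_im_pos (by simpa using h1)]
    push_cast; ring
  rw [h5, h6, ← h4]; ring

open Complex in
/-- The integral of the polar integrand over a horizontal segment is the leading term, up to an
error controlled by the lower sides of a rectangle around the origin. -/
theorem norm_integral_polarIntegrand_sub_mainTerm_le {t y : ℝ} (ht : 0 < t) (hy : 0 < y)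
    (hy' : y ≤ 1 / 20) :
    ‖(∫ x in (-(1 / 2) : ℝ)..(1 / 2), polarIntegrand t (x + y * I)) - mainTerm t‖ ≤
      2 * Real.exp Real.pi * Real.exp (2 * Real.pi * t * y) := by
  obtain ⟨G, hG'⟩ := (differentiable_polarIntegrand_exp t).isExactOn_univ
  have hG := fun ζ => hG' ζ (Set.mem_univ ζ)
  set K := Real.exp Real.pi * Real.exp (2 * Real.pi * t * y) with hK
  have hK0 : 0 < K := by positivity
  set A : ℂ := (-(1 / 2) : ℝ) + y * I with hA
  set B : ℂ := (1 / 2 : ℝ) + y * I with hB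
  set A' : ℂ := (-(1 / 2) : ℝ) + (-y : ℝ) * I with hA'
  set B' : ℂ := (1 / 2 : ℝ) + (-y : ℝ) * I with hB'
  -- On the vertical sides $|\tau|^2 \ge 1/4$, so $\operatorname{Im}\tau/|\tau|^2 \le 4y \le 1/5$.
  -- On the bottom side $\operatorname{Im}(\tau) < 0$, so $e^{2\pi i/\tau}$ has modulus at most $1$.
  have vert : ∀ τ : ℂ, τ.re ^ 2 = 1 / 4 → |τ.im| ≤ y →
      I * τ ∈ slitPlane ∧ ‖polarIntegrand t τ‖ ≤ K := by
    intro τ h1 h2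
    have hi := abs_le.mp h2
    have hn : normSq τ = 1 / 4 + τ.im ^ 2 := by rw [normSq_apply, ← h1]; ring
    refine ⟨?_, norm_polarIntegrand_le ht.le ?_ hi.2 ?_⟩
    · rw [mem_slitPlane_iff]; right
      simp only [mul_im, I_re, I_im, zero_mul, one_mul, zero_add]
      intro h; rw [h] at h1; norm_num at h1
    · rw [← sq_le_one_iff₀ (norm_nonneg _), ← normSq_eq_norm_sq, hn]; nlinarith
    · rw [hn, div_le_iff₀ (by positivity)]; nlinarith
  have horiz : ∀ τ : ℂ, |τ.re| ≤ 1 / 2 → τ.im = -y →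
      I * τ ∈ slitPlane ∧ ‖polarIntegrand t τ‖ ≤ K := by
    intro τ h1 h2
    have hr := abs_le.mp h1
    have hn : normSq τ = τ.re ^ 2 + y ^ 2 := by rw [normSq_apply, h2]; ring
    refine ⟨?_, norm_polarIntegrand_le ht.le ?_ ?_ ?_⟩
    · rw [mem_slitPlane_iff]; left; simp [h2, hy]
    · rw [← sq_le_one_iff₀ (norm_nonneg _), ← normSq_eq_norm_sq, hn]; nlinarith
    · rw [h2]; linarith
    · rw [hn, h2, div_le_iff₀ (by positivity)]; nlinarith [sq_nonneg τ.re, sq_nonneg y]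
  have seg : ∀ a b τ : ℂ, τ ∈ segment ℝ a b → ∃ u v : ℝ, 0 ≤ u ∧ 0 ≤ v ∧ u + v = 1 ∧
      τ.re = u * a.re + v * b.re ∧ τ.im = u * a.im + v * b.im := by
    rintro a b τ ⟨u, v, hu, hv, huv, rfl⟩
    exact ⟨u, v, hu, hv, huv, by simp, by simp⟩
  have l1 : ∀ τ ∈ segment ℝ A A', I * τ ∈ slitPlane ∧ ‖polarIntegrand t τ‖ ≤ K := by
    intro τ hτ
    obtain ⟨u, v, hu, hv, huv, hr, hi⟩ := seg _ _ _ hτ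
    simp [hA, hA'] at hr hi
    have hv' : v = 1 - u := by linarith
    subst hv'
    refine vert τ ?_ ?_
    · rw [hr]; ring
    · rw [hi, abs_le]; constructor <;> nlinarith
  have l2 : ∀ τ ∈ segment ℝ A' B', I * τ ∈ slitPlane ∧ ‖polarIntegrand t τ‖ ≤ K := by
    intro τ hτ
    obtain ⟨u, v, hu, hv, huv, hr, hi⟩ := seg _ _ _ hτ
    simp [hB', hA'] at hr hi
    have hv' : v = 1 - u := by linarith
    subst hv'
    refine horiz τ ?_ ?_
    · rw [hr, abs_le]; constructor <;> nlinarith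
    · rw [hi]; ring
  have l3 : ∀ τ ∈ segment ℝ B' B, I * τ ∈ slitPlane ∧ ‖polarIntegrand t τ‖ ≤ K := by
    intro τ hτ
    obtain ⟨u, v, hu, hv, huv, hr, hi⟩ := seg _ _ _ hτ
    simp [hB', hB] at hr hi
    have hv' : v = 1 - u := by linarith
    subst hv'
    refine vert τ ?_ ?_
    · rw [hr]; ring
    · rw [hi, abs_le]; constructor <;> nlinarith
  have b1 := norm_primitive_sub_le hG (fun τ h => (l1 τ h).1) (fun τ h => (l1 τ h).2)
  have b2 := norm_primitive_sub_le hG (fun τ h => (l2 τ h).1) (fun τ h => (l2 τ h).2)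
  have b3 := norm_primitive_sub_le hG (fun τ h => (l3 τ h).1) (fun τ h => (l3 τ h).2)
  have n1 : ‖A' - A‖ = 2 * y := by
    have : A' - A = -((2 * y : ℝ) * I) := by simp [hA, hA']; ring
    rw [this, norm_neg, norm_mul, norm_I, norm_real, Real.norm_of_nonneg (by positivity), mul_one]
  have n2 : ‖B' - A'‖ = 1 := by
    have : B' - A' = 1 := by simp [hB', hA']; norm_num
    rw [this, norm_one]
  have n3 : ‖B - B'‖ = 2 * y := by
    have : B - B' = (2 * y : ℝ) * I := by simp [hB, hB']; ring
    rw [this, norm_mul, norm_I, norm_real, Real.norm_of_nonneg (by positivity), mul_one]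
  rw [n1, log_I_mul_of_re_neg (z := A) (by simp [hA]) (by simpa [hA] using hy)] at b1
  rw [n2] at b2
  rw [n3, log_I_mul_of_re_pos (z := B) (by simp [hB])] at b3
  rw [integral_polarIntegrand_eq hy hG, ← primitive_sub_eq_mainTerm ht hG (log A)]
  set g1 := G (log (I * A') - Real.pi / 2 * I)
  set g2 := G (log (I * B') - Real.pi / 2 * I)
  -- Top side minus period telescopes over the three lower sides, whose total length $1 + 4y$ is at
  -- most $2$.
  have e : G (log B) - G (log A) - (G (log A - 2 * Real.pi * I) - G (log A)) =
      (g1 - G (log A - 2 * Real.pi * I)) + (g2 - g1) + (G (log B) - g2) := by ring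
  have hK2 : 2 * Real.exp Real.pi * Real.exp (2 * Real.pi * t * y) = 2 * K := by rw [hK]; ring
  rw [e, hK2]
  refine (norm_add₃_le).trans ?_
  nlinarith

/-! ### The exact order of $I_{13}$ -/

theorem centralBinom_sq_mul_le (m : ℕ) : m.centralBinom ^ 2 * (2 * m + 1) ≤ 16 ^ m := by
  induction m with
  | zero => simp
  | succ m ih =>
    have h := Nat.succ_mul_centralBinom_succ m
    have h2 : (m + 1) ^ 2 * ((m + 1).centralBinom ^ 2 * (2 * (m + 1) + 1)) ≤
        (m + 1) ^ 2 * 16 ^ (m + 1) := by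
      calc (m + 1) ^ 2 * ((m + 1).centralBinom ^ 2 * (2 * (m + 1) + 1))
          = ((m + 1) * (m + 1).centralBinom) ^ 2 * (2 * m + 3) := by ring
        _ = (m.centralBinom ^ 2 * (2 * m + 1)) * (4 * ((2 * m + 1) * (2 * m + 3))) := by
          rw [h]; ring
        _ ≤ 16 ^ m * (4 * (4 * (m + 1) ^ 2)) := by
          exact Nat.mul_le_mul ih (Nat.mul_le_mul_left 4 (by nlinarith))
        _ = _ := by ring
    exact Nat.le_of_mul_le_mul_left h2 (by positivity)

/-- The binomial coefficient `(2k+13).choose k`, written so as to match the Bessel series. -/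
theorem choose_eq_factorial_div (k : ℕ) : (((2 * k + 13).choose k : ℕ) : ℝ) =
    (2 * k + 13).factorial / (k.factorial * (k + 13).factorial) := by
  rw [Nat.cast_choose ℝ (by omega), show 2 * k + 13 - k = k + 13 by omega]

theorem choose_mul_sqrt_le (k : ℕ) :
    ((2 * k + 13).choose k : ℝ) * √(2 * k + 13) ≤ 2 ^ (2 * k + 14) := by
  have h1 : (2 * k + 13).choose k ≤ (k + 7).centralBinom :=
    (Nat.choose_le_succ _ _).trans (by
      have := Nat.choose_le_centralBinom k (k + 7)
      rwa [show 2 * (k + 7) = (2 * k + 13).succ by omega] at this)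
  have h2 : ((k + 7).centralBinom : ℝ) ^ 2 * (2 * (k + 7 : ℕ) + 1) ≤ 16 ^ (k + 7) := by
    exact_mod_cast centralBinom_sq_mul_le (k + 7)
  have h1' : ((2 * k + 13).choose k : ℝ) ≤ (k + 7).centralBinom := Nat.cast_le.mpr h1
  have h0 : (0 : ℝ) ≤ (2 * k + 13).choose k := Nat.cast_nonneg _
  push_cast at h2
  generalize ((2 * k + 13).choose k : ℝ) = a at *
  generalize ((k + 7).centralBinom : ℝ) = b at *
  refine (sq_le_sq₀ (by positivity) (by positivity)).mp ?_
  rw [mul_pow, Real.sq_sqrt (by positivity)]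
  calc a ^ 2 * (2 * k + 13) ≤ b ^ 2 * (2 * (k + 7) + 1) :=
        mul_le_mul (pow_le_pow_left₀ h0 h1' 2) (by linarith) (by positivity) (by positivity)
    _ ≤ 16 ^ (k + 7) := h2
    _ = _ := by rw [show (16 : ℝ) = 2 ^ 4 by norm_num, ← pow_mul, ← pow_mul]; ring_nf

theorem choose_succ_mul (k : ℕ) :
    ((2 * (k + 1) + 13).choose (k + 1) : ℝ) * ((k + 1) * (k + 14)) =
      ((2 * k + 13).choose k : ℝ) * ((2 * k + 15) * (2 * k + 14)) := by
  have h1 : ((2 * (k + 1) + 13).factorial : ℝ) =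
      (2 * k + 15) * ((2 * k + 14) * (2 * k + 13).factorial) := by
    rw [show 2 * (k + 1) + 13 = 2 * k + 13 + 1 + 1 by ring, Nat.factorial_succ,
      Nat.factorial_succ (2 * k + 13)]
    push_cast; ring
  have h2 : ((k + 1 + 13).factorial : ℝ) = (k + 14) * (k + 13).factorial := by
    rw [show k + 1 + 13 = k + 13 + 1 by ring, Nat.factorial_succ]
    push_cast; ring
  have h3 : ((k + 1).factorial : ℝ) = (k + 1) * k.factorial := by
    rw [Nat.factorial_succ]; push_cast; ring
  have n1 : ((k + 13).factorial : ℝ) ≠ 0 := by exact_mod_cast Nat.factorial_ne_zero _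
  have n2 : (k.factorial : ℝ) ≠ 0 := by exact_mod_cast Nat.factorial_ne_zero _
  rw [choose_eq_factorial_div, choose_eq_factorial_div, h1, h2, h3]
  generalize ((2 * k + 13).factorial : ℝ) = a
  generalize ((k + 13).factorial : ℝ) = b at *
  generalize (k.factorial : ℝ) = c at *
  have n3 : (k + 1 : ℝ) ≠ 0 := by positivity
  have n4 : (k + 14 : ℝ) ≠ 0 := by positivity
  field_simp

theorem sixteen_pow_le_choose_sq_mul (k : ℕ) :
    (16 : ℝ) ^ k ≤ ((2 * k + 13).choose k : ℝ) ^ 2 * (2 * k + 13) := by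
  induction k with
  | zero => norm_num
  | succ k ih =>
    have hrec := choose_succ_mul k
    push_cast
    generalize ((2 * (k + 1) + 13).choose (k + 1) : ℝ) = b at *
    generalize ((2 * k + 13).choose k : ℝ) = a at *
    have hpos : (0 : ℝ) < ((k + 1) * (k + 14)) ^ 2 := by positivity
    refine le_of_mul_le_mul_left ?_ hpos
    have hpoly : (16 : ℝ) * ((k + 1) * (k + 14)) ^ 2 * (2 * k + 13) ≤
        ((2 * k + 15) * (2 * k + 14)) ^ 2 * (2 * k + 15) := by
      have hk : (0 : ℝ) ≤ k := k.cast_nonneg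
      have : ((2 * k + 15) * (2 * k + 14)) ^ 2 * (2 * k + 15) -
        (16 : ℝ) * ((k + 1) * (k + 14)) ^ 2 * (2 * k + 13) =
        2712 * k ^ 3 + 58316 * k ^ 2 + 359968 * k + 620732 := by ring
      have : (0 : ℝ) ≤ 2712 * k ^ 3 + 58316 * k ^ 2 + 359968 * k + 620732 := by positivity
      linarith
    calc ((k + 1) * (k + 14) : ℝ) ^ 2 * 16 ^ (k + 1)
        = 16 * ((k + 1) * (k + 14)) ^ 2 * 16 ^ k := by ring
      _ ≤ 16 * ((k + 1) * (k + 14)) ^ 2 * (a ^ 2 * (2 * k + 13)) :=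
          mul_le_mul_of_nonneg_left ih (by positivity)
      _ = a ^ 2 * (16 * ((k + 1) * (k + 14)) ^ 2 * (2 * k + 13)) := by ring
      _ ≤ a ^ 2 * (((2 * k + 15) * (2 * k + 14)) ^ 2 * (2 * k + 15)) :=
          mul_le_mul_of_nonneg_left hpoly (by positivity)
      _ = (a * ((2 * k + 15) * (2 * k + 14))) ^ 2 * (2 * k + 15) := by ring
      _ = _ := by rw [← hrec]; ring

theorem four_pow_le_choose_mul_sqrt (k : ℕ) :
    4 ^ k ≤ ((2 * k + 13).choose k : ℝ) * √(2 * k + 13) := by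
  refine (sq_le_sq₀ (by positivity) (by positivity)).mp ?_
  rw [mul_pow, Real.sq_sqrt (by positivity)]
  refine le_trans (le_of_eq ?_) (sixteen_pow_le_choose_sq_mul k)
  rw [← pow_mul, mul_comm, pow_mul]; norm_num

/-- With $N = 2k+13$, this exhibits $I_{13}$ as the odd exponential series weighted by
$\binom{N}{k}/2^N$, a weight of order $1/\sqrt N$. The mass sits near $N \approx x$, which suggests
$e^x/\sqrt x$. -/
theorem besselI_term_eq (x : ℝ) (k : ℕ) :
    (x / 2) ^ (2 * k + 13) / ((k.factorial : ℝ) * ((k + 13).factorial : ℝ)) =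
    x ^ (2 * k + 13) / (2 * k + 13).factorial * (((2 * k + 13).choose k : ℝ) / 2 ^ (2 * k + 13)) := by
  rw [choose_eq_factorial_div, div_pow]
  field_simp

theorem summable_besselI (x : ℝ) : Summable fun k : ℕ =>
    (x / 2) ^ (2 * k + 13) / ((k.factorial : ℝ) * ((k + 13).factorial : ℝ)) := by
  refine Summable.of_norm_bounded
    ((Real.summable_pow_div_factorial ((x / 2) ^ 2)).mul_left (|x / 2| ^ 13)) fun k => ?_
  have h1 : (1 : ℝ) ≤ (k + 13).factorial := by
    exact_mod_cast Nat.one_le_iff_ne_zero.mpr (Nat.factorial_ne_zero (k + 13))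
  rw [norm_div, norm_mul, norm_pow, Real.norm_eq_abs, Real.norm_natCast, Real.norm_natCast,
    pow_add, pow_mul, sq_abs, mul_comm (((x / 2) ^ 2) ^ k), mul_div_assoc]
  gcongr
  exact le_mul_of_one_le_right (by positivity) h1

theorem hasSum_sinh_shift (x : ℝ) : HasSum (fun k : ℕ => x ^ (2 * k + 13) / (2 * k + 13).factorial)
    (Real.sinh x - ∑ i ∈ Finset.range 6, x ^ (2 * i + 1) / (2 * i + 1).factorial) :=
  (hasSum_nat_add_iff' 6).mpr (Real.hasSum_sinh x)

theorem hasSum_cosh_shift (x : ℝ) (m : ℕ) :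
    HasSum (fun k : ℕ => x ^ (2 * k + 2 * m) / (2 * k + 2 * m).factorial)
    (Real.cosh x - ∑ i ∈ Finset.range m, x ^ (2 * i) / (2 * i).factorial) := by
  have := (hasSum_nat_add_iff' m).mpr (Real.hasSum_cosh x)
  simpa only [mul_add] using this

theorem besselI_le {x : ℝ} (hx : 0 < x) : VW.besselI 13 x ≤ 3 * (Real.exp x / √x) := by
  have hsx : 0 < √x := Real.sqrt_pos.mpr hx
  have hsum := ((hasSum_sinh_shift x).add ((hasSum_cosh_shift x 7).mul_left 2)).mul_left (1 / √x)
  have hle := hasSum_le (fun k => ?_) (summable_besselI x).hasSum hsum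
  · refine hle.trans ?_
    have h1 : 0 ≤ ∑ i ∈ Finset.range 6, x ^ (2 * i + 1) / (2 * i + 1).factorial :=
      Finset.sum_nonneg fun i _ => by positivity
    have h2 : 0 ≤ ∑ i ∈ Finset.range 7, x ^ (2 * i) / (2 * i).factorial :=
      Finset.sum_nonneg fun i _ => by positivity
    have h3 : Real.sinh x ≤ Real.exp x := by
      rw [Real.sinh_eq]; linarith [Real.exp_pos x, Real.exp_pos (-x)]
    have h4 : Real.cosh x ≤ Real.exp x := by
      rw [Real.cosh_eq]
      have : Real.exp (-x) ≤ Real.exp x := Real.exp_le_exp.mpr (by linarith)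
      linarith
    calc _ ≤ 1 / √x * (3 * Real.exp x) :=
          mul_le_mul_of_nonneg_left (by linarith) (by positivity)
      _ = _ := by ring
  · rw [besselI_term_eq]
    have hN : (0 : ℝ) < 2 * k + 13 := by positivity
    have hsN : 0 < √(2 * k + 13 : ℝ) := Real.sqrt_pos.mpr hN
    have h1 : ((2 * k + 13).choose k : ℝ) / 2 ^ (2 * k + 13) ≤ 2 / √(2 * k + 13) := by
      rw [div_le_div_iff₀ (by positivity) hsN]
      refine (choose_mul_sqrt_le k).trans (le_of_eq ?_)
      rw [pow_succ]; ring
    -- AM-GM for $1/\sqrt x$ and $\sqrt x/N$ linearises the weight $1/\sqrt N$; the factor $x/N$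
    -- then shifts the series by one degree, into that of $\cosh$.
    have h2 : 2 / √(2 * k + 13 : ℝ) ≤ 1 / √x * (1 + x / (2 * k + 13)) := by
      have : 1 / √x * (1 + x / (2 * k + 13)) - 2 / √(2 * k + 13 : ℝ) =
          (√(2 * k + 13 : ℝ) - √x) ^ 2 / (√x * √(2 * k + 13 : ℝ) ^ 2) := by
        nth_rw 2 [← Real.sq_sqrt hx.le]
        nth_rw 1 [← Real.sq_sqrt hN.le]
        field_simp
        ring
      have h3 : 0 ≤ (√(2 * k + 13 : ℝ) - √x) ^ 2 / (√x * √(2 * k + 13 : ℝ) ^ 2) := by positivity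
      linarith
    have h3 : x ^ (2 * k + 13) / (2 * k + 13).factorial * (x / (2 * k + 13)) ≤
        2 * (x ^ (2 * k + 2 * 7) / (2 * k + 2 * 7).factorial) := by
      have e : ((2 * k + 2 * 7).factorial : ℝ) = (2 * k + 14) * (2 * k + 13).factorial := by
        rw [show 2 * k + 2 * 7 = 2 * k + 13 + 1 by ring, Nat.factorial_succ]; push_cast; ring
      have hf : (0 : ℝ) < (2 * k + 13).factorial := by exact_mod_cast Nat.factorial_pos _
      rw [e]
      generalize ((2 * k + 13).factorial : ℝ) = f at *
      have e2 : x ^ (2 * k + 13) / f * (x / (2 * k + 13)) =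
          x ^ (2 * k + 14) / f * (1 / (2 * k + 13)) := by
        rw [pow_succ x (2 * k + 13)]; field_simp
      have e3 : 2 * (x ^ (2 * k + 2 * 7) / ((2 * k + 14) * f)) =
          x ^ (2 * k + 14) / f * (2 / (2 * k + 14)) := by
        rw [show 2 * k + 2 * 7 = 2 * k + 14 by ring]; field_simp
      rw [e2, e3]
      refine mul_le_mul_of_nonneg_left ?_ (by positivity)
      rw [div_le_div_iff₀ hN (by positivity)]
      have : (0 : ℝ) ≤ k := k.cast_nonneg
      linarith
    have hq : 0 ≤ x ^ (2 * k + 13) / ((2 * k + 13).factorial : ℝ) := by positivity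
    calc _ ≤ x ^ (2 * k + 13) / ((2 * k + 13).factorial : ℝ) *
          (1 / √x * (1 + x / (2 * k + 13))) := mul_le_mul_of_nonneg_left (h1.trans h2) hq
      _ = 1 / √x * (x ^ (2 * k + 13) / ((2 * k + 13).factorial : ℝ) +
          x ^ (2 * k + 13) / ((2 * k + 13).factorial : ℝ) * (x / (2 * k + 13))) := by ring
      _ ≤ _ := mul_le_mul_of_nonneg_left (by linarith) (by positivity)

theorem eventually_le_besselI :
    ∀ᶠ x : ℝ in atTop, 1 / 2 ^ 15 * (Real.exp x / √x) ≤ VW.besselI 13 x := by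
  -- The missing initial terms of the $\sinh$ series form a polynomial. The constant $1/12$ below
  -- makes $\frac32 \cdot \frac1{12} = \frac18$, so that $\frac32\sinh - \frac12\cosh$ minus this
  -- loss still keeps $\frac14 e^x$.
  have hP : (fun x : ℝ => ∑ i ∈ Finset.range 6, x ^ (2 * i + 1) / (2 * i + 1).factorial)
      =o[atTop] Real.exp := by
    refine IsLittleO.fun_sum fun i _ => ?_
    simp only [div_eq_mul_inv]
    exact (Real.isLittleO_pow_exp_atTop (n := 2 * i + 1)).mul_isBigO (isBigO_const_const _ one_ne_zero _)
      |>.congr_right fun x => mul_one _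
  filter_upwards [hP.bound (by norm_num : (0 : ℝ) < 1 / 12), eventually_ge_atTop 2] with x hPx hx2
  have hx : 0 < x := by linarith
  have hsx : 0 < √x := Real.sqrt_pos.mpr hx
  have hsum := (((hasSum_sinh_shift x).mul_left (3 / 2)).sub
    ((hasSum_cosh_shift x 6).mul_left (1 / 2))).mul_left (1 / 2 ^ 13 * (1 / √x))
  have hle := hasSum_le (fun k => ?_) hsum (summable_besselI x).hasSum
  · refine le_trans ?_ hle
    have h2 : 0 ≤ ∑ i ∈ Finset.range 6, x ^ (2 * i) / (2 * i).factorial :=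
      Finset.sum_nonneg fun i _ => by positivity
    rw [Real.norm_of_nonneg (Finset.sum_nonneg fun i _ => by positivity),
      Real.norm_of_nonneg (Real.exp_nonneg _)] at hPx
    have h3 : Real.exp (-x) ≤ 1 / 8 * Real.exp x := by
      have h5 : Real.exp (-x) ≤ Real.exp 0 := Real.exp_le_exp.mpr (by linarith)
      have h6 : Real.exp (-x) * Real.exp x = 1 := by rw [← Real.exp_add]; simp
      rw [Real.exp_zero] at h5
      have h7 := Real.quadratic_le_exp_of_nonneg hx.le
      have h8 : 5 ≤ Real.exp x := by nlinarith
      have h9 : Real.exp (-x) ≤ 1 / 5 := by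
        nlinarith [Real.exp_pos (-x)]
      linarith
    have h4 : 1 / 4 * Real.exp x ≤ 3 / 2 * (Real.sinh x -
        ∑ i ∈ Finset.range 6, x ^ (2 * i + 1) / (2 * i + 1).factorial) -
        1 / 2 * (Real.cosh x - ∑ i ∈ Finset.range 6, x ^ (2 * i) / (2 * i).factorial) := by
      rw [Real.sinh_eq, Real.cosh_eq]
      linarith
    calc _ = 1 / 2 ^ 13 * (1 / √x) * (1 / 4 * Real.exp x) := by ring
      _ ≤ _ := mul_le_mul_of_nonneg_left h4 (by positivity)
  · rw [besselI_term_eq]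
    have hN : (0 : ℝ) < 2 * k + 13 := by positivity
    have hsN : 0 < √(2 * k + 13 : ℝ) := Real.sqrt_pos.mpr hN
    have h1 : 1 / 2 ^ 13 * (1 / √(2 * k + 13)) ≤
        ((2 * k + 13).choose k : ℝ) / 2 ^ (2 * k + 13) := by
      rw [div_mul_div_comm, div_le_div_iff₀ (by positivity) (by positivity)]
      calc 1 * 1 * 2 ^ (2 * k + 13) = 2 ^ 13 * (4 : ℝ) ^ k := by
            rw [show (4 : ℝ) = 2 ^ 2 by norm_num, ← pow_mul]; ring
        _ ≤ 2 ^ 13 * (((2 * k + 13).choose k : ℝ) * √(2 * k + 13)) :=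
          mul_le_mul_of_nonneg_left (four_pow_le_choose_mul_sqrt k) (by positivity)
        _ = _ := by ring
    -- The tangent line at $N = x$ lies below the convex function $N \mapsto N^{-1/2}$; the factor
    -- $N/x$ shifts the series down one degree.
    have h2 : 1 / √x * (3 / 2 - 1 / 2 * ((2 * k + 13) / x)) ≤ 1 / √(2 * k + 13 : ℝ) := by
      have : 1 / √(2 * k + 13 : ℝ) - 1 / √x * (3 / 2 - 1 / 2 * ((2 * k + 13) / x)) =
          (√(2 * k + 13 : ℝ) - √x) ^ 2 * (√(2 * k + 13 : ℝ) + 2 * √x) /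
            (2 * √x ^ 3 * √(2 * k + 13 : ℝ)) := by
        nth_rw 2 [← Real.sq_sqrt hx.le]
        nth_rw 2 [← Real.sq_sqrt hN.le]
        field_simp
        ring
      have h3 : 0 ≤ (√(2 * k + 13 : ℝ) - √x) ^ 2 * (√(2 * k + 13 : ℝ) + 2 * √x) /
            (2 * √x ^ 3 * √(2 * k + 13 : ℝ)) := by positivity
      linarith
    have h3 : x ^ (2 * k + 2 * 6) / (2 * k + 2 * 6).factorial =
        x ^ (2 * k + 13) / (2 * k + 13).factorial * ((2 * k + 13) / x) := by
      have e : ((2 * k + 13).factorial : ℝ) = (2 * k + 13) * (2 * k + 2 * 6).factorial := by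
        rw [show 2 * k + 13 = 2 * k + 2 * 6 + 1 by ring, Nat.factorial_succ]; push_cast; ring
      have hf : ((2 * k + 2 * 6).factorial : ℝ) ≠ 0 := by exact_mod_cast Nat.factorial_ne_zero _
      rw [e, show 2 * k + 13 = 2 * k + 2 * 6 + 1 by ring, pow_succ]
      generalize ((2 * k + 2 * 6).factorial : ℝ) = f at *
      field_simp
      ring
    have hq : 0 ≤ x ^ (2 * k + 13) / ((2 * k + 13).factorial : ℝ) := by positivity
    rw [h3]
    calc _ = x ^ (2 * k + 13) / ((2 * k + 13).factorial : ℝ) *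
          (1 / 2 ^ 13 * (1 / √x * (3 / 2 - 1 / 2 * ((2 * k + 13) / x)))) := by ring
      _ ≤ _ := mul_le_mul_of_nonneg_left
        ((mul_le_mul_of_nonneg_left h2 (by positivity)).trans h1) hq

/-! ### The circle method on a horizontal line -/

theorem halfGaussian_eq {y : ℝ} (t : ℝ) : halfGaussian y t =
    y ^ 12 * Real.exp (Real.pi / (2 * y)) * Real.exp (-(Real.pi / (4 * y ^ 3)) * t ^ 2) := by
  rw [halfGaussian, mul_assoc, ← Real.exp_add]; congr 2; ring

theorem integrable_halfGaussian {y : ℝ} (hy : 0 < y) :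
    MeasureTheory.Integrable (halfGaussian y) := by
  have h := (integrable_exp_neg_mul_sq (by positivity : 0 < Real.pi / (4 * y ^ 3))).const_mul
    (y ^ 12 * Real.exp (Real.pi / (2 * y)))
  exact h.congr (.of_forall fun t => (halfGaussian_eq t).symm)

theorem integral_halfGaussian {y : ℝ} (hy : 0 < y) : ∫ t, halfGaussian y t =
    y ^ 12 * Real.exp (Real.pi / (2 * y)) * √(4 * y ^ 3) := by
  simp_rw [halfGaussian_eq, MeasureTheory.integral_const_mul, integral_gaussian]
  congr 2
  have := Real.pi_ne_zero
  field_simp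

theorem intervalIntegral_halfGaussian_le {y : ℝ} (hy : 0 < y) (c : ℝ) :
    ∫ x in (-(1 / 2) : ℝ)..(1 / 2), halfGaussian y (x + c) ≤
      y ^ 12 * Real.exp (Real.pi / (2 * y)) * √(4 * y ^ 3) := by
  rw [intervalIntegral.integral_of_le (by norm_num), ← integral_halfGaussian hy,
    ← MeasureTheory.integral_add_right_eq_self (halfGaussian y) c]
  exact MeasureTheory.setIntegral_le_integral ((integrable_halfGaussian hy).comp_add_right c)
    (.of_forall fun x => halfGaussian_nonneg hy _)

theorem continuous_eta_zpow_line {y : ℝ} (hy : 0 < y) :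
    Continuous fun x : ℝ => ModularForm.eta (x + y * Complex.I) ^ (-24 : ℤ) := by
  have him : ∀ x : ℝ, 0 < ((x : ℂ) + y * Complex.I).im := fun x => by simpa using hy
  refine continuous_iff_continuousAt.mpr fun x => ?_
  have h1 : ContinuousAt (fun x : ℝ => ModularForm.eta (x + y * Complex.I)) x :=
    ContinuousAt.comp (g := ModularForm.eta) (f := fun x : ℝ => (x + y * Complex.I : ℂ))
      (ModularForm.differentiableAt_eta_of_mem_upperHalfPlaneSet (him x)).continuousAt (by fun_prop)
  exact h1.zpow₀ _ (Or.inl (ModularForm.eta_ne_zero (him x)))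

theorem continuous_polarIntegrand_line (t : ℝ) {y : ℝ} (hy : 0 < y) :
    Continuous fun x : ℝ => polarIntegrand t (x + y * Complex.I) := by
  have hne : ∀ x : ℝ, (x : ℂ) + y * Complex.I ≠ 0 := fun x h => by
    have := congrArg Complex.im h
    simp [hy.ne'] at this
  unfold polarIntegrand
  have : Continuous fun x : ℝ => 2 * Real.pi * Complex.I / (x + y * Complex.I : ℂ) :=
    continuous_const.div (by fun_prop) hne
  fun_prop

/-- The circle method for `η ^ (-24)` on the line of height `y`. -/
theorem exists_norm_a_sub_mainTerm_le : ∃ C : ℝ, 0 < C ∧ ∀ (n : ℕ) (y : ℝ), 0 < n → 0 < y →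
    y ≤ 1 / 20 → ‖VW.a n - mainTerm n‖ ≤ C * Real.exp (2 * Real.pi * n * y) *
      (Real.exp (Real.pi / (4 * y)) + y ^ 12 * Real.exp (Real.pi / (2 * y)) * √(4 * y ^ 3)) := by
  obtain ⟨C, hC, hbound⟩ := exists_norm_eta_zpow_sub_polar_le
  refine ⟨2 * C + 2 * Real.exp Real.pi, by positivity, fun n y hn hy hy' => ?_⟩
  set K := y ^ 12 * Real.exp (Real.pi / (2 * y)) * √(4 * y ^ 3) with hK
  set Q := Real.exp (2 * Real.pi * n * y) with hQ
  set R := Real.exp (Real.pi / (4 * y)) with hR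
  have hR1 : 1 ≤ R := Real.one_le_exp (by positivity)
  have hK0 : 0 ≤ K := by positivity
  have hnr : (0 : ℝ) < n := by exact_mod_cast hn
  have h1 := norm_integral_polarIntegrand_sub_mainTerm_le hnr hy hy'
  have h2 := a_eq_integral n hy
  have hcexp : Continuous fun x : ℝ =>
      Complex.exp (-(2 * Real.pi * Complex.I * (n : ℤ) * (x + y * Complex.I))) := by fun_prop
  have h3 : VW.a n - ∫ x in (-(1 / 2) : ℝ)..(1 / 2), polarIntegrand n (x + y * Complex.I) =
      ∫ x in (-(1 / 2) : ℝ)..(1 / 2), (ModularForm.eta (x + y * Complex.I) ^ (-24 : ℤ) -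
        (x + y * Complex.I) ^ 12 * Complex.exp (2 * Real.pi * Complex.I / (x + y * Complex.I))) *
      Complex.exp (-(2 * Real.pi * Complex.I * (n : ℤ) * (x + y * Complex.I))) := by
    have hcmul : Continuous fun x : ℝ => ModularForm.eta (x + y * Complex.I) ^ (-24 : ℤ) *
        Complex.exp (-(2 * Real.pi * Complex.I * (n : ℤ) * (x + y * Complex.I))) :=
      (continuous_eta_zpow_line hy).mul hcexp
    rw [h2, ← intervalIntegral.integral_sub (hcmul.intervalIntegrable _ _)
      ((continuous_polarIntegrand_line n hy).intervalIntegrable _ _)]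
    refine intervalIntegral.integral_congr fun x _ => ?_
    simp only [polarIntegrand]
    push_cast
    ring
  have hg1 := (((integrable_halfGaussian hy).comp_add_right (-(1 / 2))).intervalIntegrable
    (a := -(1 / 2)) (b := 1 / 2))
  have hg2 := (((integrable_halfGaussian hy).comp_add_right (1 / 2)).intervalIntegrable
    (a := -(1 / 2)) (b := 1 / 2))
  have hgi : IntervalIntegrable (fun x : ℝ => C * Q * (R + (halfGaussian y (x + -(1 / 2)) +
      halfGaussian y (x + 1 / 2)))) MeasureTheory.volume (-(1 / 2)) (1 / 2) :=
    (intervalIntegrable_const.add (hg1.add hg2)).const_mul (C * Q)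
  have h4 := intervalIntegral.norm_integral_le_of_norm_le
    (f := fun x : ℝ => (ModularForm.eta (x + y * Complex.I) ^ (-24 : ℤ) -
        (x + y * Complex.I) ^ 12 * Complex.exp (2 * Real.pi * Complex.I / (x + y * Complex.I))) *
      Complex.exp (-(2 * Real.pi * Complex.I * (n : ℤ) * (x + y * Complex.I))))
    (by norm_num : (-(1 / 2) : ℝ) ≤ 1 / 2) (.of_forall fun x hx => ?_) hgi
  · rw [← h3, intervalIntegral.integral_const_mul,
      intervalIntegral.integral_add intervalIntegrable_const (hg1.add hg2),
      intervalIntegral.integral_add hg1 hg2, intervalIntegral.integral_const] at h4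
    have h5 := intervalIntegral_halfGaussian_le hy (-(1 / 2))
    have h6 := intervalIntegral_halfGaussian_le hy (1 / 2)
    have h7 : ‖VW.a n - ∫ x in (-(1 / 2) : ℝ)..(1 / 2), polarIntegrand n (x + y * Complex.I)‖ ≤
        C * Q * (R + (K + K)) := by
      refine h4.trans (mul_le_mul_of_nonneg_left (add_le_add ?_ (add_le_add h5 h6)) (by positivity))
      norm_num
    have h8 := norm_sub_le_norm_sub_add_norm_sub (VW.a n)
      (∫ x in (-(1 / 2) : ℝ)..(1 / 2), polarIntegrand n (x + y * Complex.I)) (mainTerm n : ℂ)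
    have hQ0 : 0 < Q := Real.exp_pos _
    have h9 : C * Q * (R + (K + K)) ≤ 2 * C * Q * (R + K) := by
      have : 0 ≤ C * Q * R := by positivity
      linarith
    have h10 : 2 * Real.exp Real.pi * Q ≤ 2 * Real.exp Real.pi * Q * (R + K) :=
      le_mul_of_one_le_right (by positivity) (by linarith)
    calc _ ≤ _ := h8
      _ ≤ 2 * C * Q * (R + K) + 2 * Real.exp Real.pi * Q * (R + K) :=
        add_le_add (h7.trans h9) (h1.trans h10)
      _ = _ := by ring
  · have h5 := hbound x y (abs_le.mpr ⟨hx.1.le, hx.2⟩) hy hy'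
    have h6 : ‖Complex.exp (-(2 * Real.pi * Complex.I * (n : ℤ) * (x + y * Complex.I)))‖ = Q := by
      have := norm_exp_neg_two_pi_I_mul ((n : ℤ) * (x + y * Complex.I))
      rw [← mul_assoc] at this
      rw [this, hQ]; congr 1; simp; ring
    rw [norm_mul, h6, ← sub_eq_add_neg]
    calc _ ≤ C * (R + (halfGaussian y (x - 1 / 2) + halfGaussian y (x + 1 / 2))) * Q :=
          mul_le_mul_of_nonneg_right h5 (Real.exp_nonneg _)
      _ = _ := by ring

/-! ### Choice of the height and comparison of sizes -/

/-- The polynomial factor `t ^ (-27/4)`. -/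
noncomputable def profile (t : ℝ) : ℝ := 1 / (√t ^ 13 * √√t)

theorem profile_pos {t : ℝ} (ht : 0 < t) : 0 < profile t := by
  have h1 := Real.sqrt_pos.mpr ht
  have h2 := Real.sqrt_pos.mpr h1
  unfold profile; positivity

theorem profile_sq_mul {c t : ℝ} (hc : 0 ≤ c) :
    profile (c ^ 2 * t) = profile t / (c ^ 13 * √c) := by
  rw [profile, profile, Real.sqrt_mul (sq_nonneg c), Real.sqrt_sq hc, Real.sqrt_mul hc, mul_pow,
    div_div]
  congr 1; ring

theorem rpow_thirteen_halves {t : ℝ} (ht : 0 ≤ t) : t ^ (13 / 2 : ℝ) = √t ^ 13 := by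
  rw [Real.sqrt_eq_rpow, ← Real.rpow_natCast, ← Real.rpow_mul ht]; norm_num

theorem mainTerm_le {t : ℝ} (ht : 0 < t) :
    mainTerm t ≤ 6 * Real.pi * (Real.exp (4 * Real.pi * √t) * profile t) := by
  have h1 := Real.sqrt_pos.mpr ht
  have h2 := Real.sqrt_pos.mpr h1
  have h3 := besselI_le (by positivity : 0 < 4 * Real.pi * √t)
  have h4 : √√t ≤ √(4 * Real.pi * √t) :=
    Real.sqrt_le_sqrt (le_mul_of_one_le_left h1.le (by linarith [Real.pi_gt_three]))
  rw [mainTerm, rpow_thirteen_halves ht.le, profile]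
  calc _ ≤ 2 * Real.pi / √t ^ 13 * (3 * (Real.exp (4 * Real.pi * √t) / √√t)) := by
        have := Real.pi_pos
        refine mul_le_mul_of_nonneg_left (h3.trans ?_) (by positivity)
        gcongr
    _ = _ := by field_simp; ring

theorem exists_le_mainTerm : ∃ c : ℝ, 0 < c ∧ ∀ᶠ t : ℝ in atTop,
    c * (Real.exp (4 * Real.pi * √t) * profile t) ≤ mainTerm t := by
  have hpi := Real.pi_pos
  have hs : 0 < √(4 * Real.pi) := Real.sqrt_pos.mpr (by positivity)
  refine ⟨2 * Real.pi * (1 / 2 ^ 15) / √(4 * Real.pi), by positivity, ?_⟩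
  have htend : Tendsto (fun t : ℝ => 4 * Real.pi * √t) atTop atTop :=
    Real.tendsto_sqrt_atTop.const_mul_atTop (by positivity)
  filter_upwards [htend.eventually eventually_le_besselI, eventually_gt_atTop 0] with t h ht
  have h1 := Real.sqrt_pos.mpr ht
  have h2 := Real.sqrt_pos.mpr h1
  rw [Real.sqrt_mul (by positivity)] at h
  rw [mainTerm, rpow_thirteen_halves ht.le, profile]
  refine le_trans (le_of_eq ?_) (mul_le_mul_of_nonneg_left h (by positivity))
  field_simp

/-- The coefficients of `η ^ (-24)`, up to the size of the second term of Rademacher's series. -/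
theorem exists_norm_a_sub_mainTerm_le_profile : ∃ C : ℝ, 0 < C ∧ ∀ᶠ n : ℕ in atTop,
    ‖VW.a n - mainTerm n‖ ≤ C * (Real.exp (2 * Real.pi * √(n : ℝ)) * profile n) := by
  obtain ⟨C, hC, h⟩ := exists_norm_a_sub_mainTerm_le
  refine ⟨2 * C, by positivity, ?_⟩
  have hpi := Real.pi_pos
  have hlo := (isLittleO_pow_exp_pos_mul_atTop 14 (by positivity : 0 < Real.pi / 2)).bound one_pos
  have htend : Tendsto (fun n : ℕ => √(n : ℝ)) atTop atTop :=
    Real.tendsto_sqrt_atTop.comp tendsto_natCast_atTop_atTop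
  filter_upwards [htend.eventually hlo, htend.eventually (eventually_ge_atTop 10),
    eventually_gt_atTop 0] with n hn1 hn2 hn
  set s := √(n : ℝ) with hs
  have hs0 : 0 < s := by linarith
  have hss : 0 < √s := Real.sqrt_pos.mpr hs0
  have hns : (n : ℝ) = s ^ 2 := (Real.sq_sqrt n.cast_nonneg).symm
  -- At this height $2\pi n y$ and $\pi/(2y)$ both equal $\pi s$; the condition $s \ge 10$ gives $y
  -- \le 1/20$.
  have h1 := h n (1 / (2 * s)) hn (by positivity) (by
    rw [div_le_div_iff₀ (by positivity) (by norm_num)]; linarith)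
  have hE : profile n = 1 / (s ^ 13 * √s) := rfl
  have e1 : 2 * Real.pi * n * (1 / (2 * s)) = Real.pi * s := by rw [hns]; field_simp
  have e2 : Real.pi / (4 * (1 / (2 * s))) = Real.pi / 2 * s := by field_simp; ring
  have e3 : Real.pi / (2 * (1 / (2 * s))) = Real.pi * s := by field_simp
  rw [e1, e2, e3] at h1
  -- The spare factor $e^{\pi s/2}$ exceeds $s^{14}$, which dominates the inverse of the profile.
  have b1 : Real.exp (Real.pi / 2 * s) ≤ Real.exp (Real.pi * s) * profile n := by
    have : Real.exp (Real.pi * s) = Real.exp (Real.pi / 2 * s) * Real.exp (Real.pi / 2 * s) := by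
      rw [← Real.exp_add]; congr 1; ring
    rw [this, mul_assoc]
    refine le_mul_of_one_le_right (Real.exp_nonneg _) ?_
    rw [hE, mul_one_div, one_le_div (by positivity)]
    rw [one_mul, Real.norm_of_nonneg (by positivity), Real.norm_of_nonneg (by positivity)] at hn1
    refine le_trans ?_ hn1
    rw [pow_succ s 13]
    refine mul_le_mul_of_nonneg_left ?_ (by positivity)
    rw [Real.sqrt_le_left hs0.le]
    nlinarith
  -- Here $y^{12}$ and the Gaussian width $y^{3/2}$ combine to $s^{-27/2} = n^{-27/4}$, exactly the
  -- power in the main term.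
  have b2 : (1 / (2 * s)) ^ 12 * Real.exp (Real.pi * s) * √(4 * (1 / (2 * s)) ^ 3) ≤
      Real.exp (Real.pi * s) * profile n := by
    have c1 : √(4 * (1 / (2 * s)) ^ 3) ≤ 1 / (s * √s) := by
      have d1 : (1 / (s * √s)) ^ 2 = 1 / s ^ 3 := by
        rw [div_pow, mul_pow, Real.sq_sqrt hs0.le]; ring
      have d2 : 4 * (1 / (2 * s)) ^ 3 = 1 / s ^ 3 / 2 := by field_simp; norm_num
      rw [Real.sqrt_le_left (by positivity), d1, d2]
      exact half_le_self (by positivity)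
    have c2 : (1 / (2 * s)) ^ 12 ≤ 1 / s ^ 12 := by
      rw [div_pow, one_pow]
      gcongr
      linarith
    calc _ ≤ 1 / s ^ 12 * Real.exp (Real.pi * s) * (1 / (s * √s)) := by gcongr
      _ = _ := by rw [hE]; field_simp
  have b3 : Real.exp (2 * Real.pi * s) = Real.exp (Real.pi * s) * Real.exp (Real.pi * s) := by
    rw [← Real.exp_add]; congr 1; ring
  calc _ ≤ _ := h1
    _ ≤ C * Real.exp (Real.pi * s) * (Real.exp (Real.pi * s) * profile n +
        Real.exp (Real.pi * s) * profile n) :=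
      mul_le_mul_of_nonneg_left (add_le_add b1 b2) (by positivity)
    _ = _ := by rw [b3]; ring

theorem exists_norm_a_sub_le_mul_mainTerm : ∃ C : ℝ, 0 < C ∧ ∀ᶠ n : ℕ in atTop,
    ‖VW.a n - mainTerm n‖ ≤ C / Real.exp (2 * Real.pi * √(n : ℝ)) * mainTerm n := by
  obtain ⟨C, hC, h1⟩ := exists_norm_a_sub_mainTerm_le_profile
  obtain ⟨c, hc, h2⟩ := exists_le_mainTerm
  refine ⟨C / c, by positivity, ?_⟩
  filter_upwards [h1, tendsto_natCast_atTop_atTop.eventually h2] with n h1 h2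
  refine h1.trans ?_
  have e : Real.exp (4 * Real.pi * √(n : ℝ)) =
      Real.exp (2 * Real.pi * √(n : ℝ)) * Real.exp (2 * Real.pi * √(n : ℝ)) := by
    rw [← Real.exp_add]; congr 1; ring
  calc _ = C / c / Real.exp (2 * Real.pi * √(n : ℝ)) *
        (c * (Real.exp (4 * Real.pi * √(n : ℝ)) * profile n)) := by rw [e]; field_simp
    _ ≤ _ := mul_le_mul_of_nonneg_left h2 (by positivity)

theorem exists_norm_a_le : ∃ C : ℝ, 0 < C ∧ ∀ᶠ n : ℕ in atTop,
    ‖VW.a n‖ ≤ C * (Real.exp (4 * Real.pi * √(n : ℝ)) * profile n) := by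
  obtain ⟨C, hC, h1⟩ := exists_norm_a_sub_mainTerm_le_profile
  have hpi := Real.pi_pos
  refine ⟨C + 6 * Real.pi, by positivity, ?_⟩
  filter_upwards [h1, eventually_gt_atTop 0] with n h1 hn
  have hn' : (0 : ℝ) < n := by exact_mod_cast hn
  have h2 := mainTerm_le hn'
  have hp := profile_pos hn'
  have h0 : 0 ≤ mainTerm n := by
    have : 0 ≤ VW.besselI 13 (4 * Real.pi * √(n : ℝ)) := tsum_nonneg fun k => by positivity
    unfold mainTerm; positivity
  have h3 := norm_le_norm_add_norm_sub' (VW.a n) (mainTerm n : ℂ)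
  rw [Complex.norm_real, Real.norm_of_nonneg h0] at h3
  have h4 : Real.exp (2 * Real.pi * √(n : ℝ)) ≤ Real.exp (4 * Real.pi * √(n : ℝ)) := by
    rw [Real.exp_le_exp]; nlinarith [Real.sqrt_nonneg (n : ℝ)]
  have h5 : C * (Real.exp (2 * Real.pi * √(n : ℝ)) * profile n) ≤
      C * (Real.exp (4 * Real.pi * √(n : ℝ)) * profile n) := by gcongr
  linarith

/-- The coefficient `a (n / p)` is negligible against `a (p n)`. -/
theorem exists_norm_a_le_mul_mainTerm {p : ℕ} (hp : 2 ≤ p) : ∃ C : ℝ, 0 < C ∧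
    ∀ᶠ k : ℕ in atTop, ‖VW.a k‖ ≤ C / Real.exp (2 * Real.pi * √((p : ℝ) * (p * k : ℕ))) *
      mainTerm ((p : ℝ) * (p * k : ℕ)) := by
  obtain ⟨C, hC, h1⟩ := exists_norm_a_le
  obtain ⟨c, hc, h2⟩ := exists_le_mainTerm
  have hp0 : (0 : ℝ) < p := by positivity
  have hp2 : (2 : ℝ) ≤ p := by exact_mod_cast hp
  have hpi := Real.pi_pos
  have hsp : 0 < √(p : ℝ) := Real.sqrt_pos.mpr hp0
  refine ⟨C * ((p : ℝ) ^ 13 * √p) / c, by positivity, ?_⟩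
  have htend : Tendsto (fun k : ℕ => (p : ℝ) * (p * k : ℕ)) atTop atTop := by
    refine Tendsto.const_mul_atTop hp0 ?_
    push_cast
    exact Tendsto.const_mul_atTop hp0 tendsto_natCast_atTop_atTop
  filter_upwards [h1, htend.eventually h2, eventually_gt_atTop 0] with k h1 h2 hk
  have hk' : (0 : ℝ) < k := by exact_mod_cast hk
  have e0 : (p : ℝ) * (p * k : ℕ) = (p : ℝ) ^ 2 * k := by push_cast; ring
  rw [e0] at h2 ⊢
  have e1 : √((p : ℝ) ^ 2 * k) = p * √(k : ℝ) := by
    rw [Real.sqrt_mul (sq_nonneg _), Real.sqrt_sq hp0.le]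
  rw [e1, profile_sq_mul hp0.le] at h2
  rw [e1]
  have hP := profile_pos hk'
  have h3 : Real.exp (4 * Real.pi * √(k : ℝ)) ≤
      Real.exp (4 * Real.pi * (p * √(k : ℝ))) / Real.exp (2 * Real.pi * (p * √(k : ℝ))) := by
    -- The exponents to compare are $4\pi\sqrt k$ and $2\pi p\sqrt k$. They agree when $p = 2$, so
    -- there the matching powers of $k$ are needed as well.
    rw [← Real.exp_sub, Real.exp_le_exp]
    have : 2 * √(k : ℝ) ≤ p * √(k : ℝ) := by gcongr
    nlinarith
  refine h1.trans ?_
  calc _ ≤ C * (Real.exp (4 * Real.pi * (p * √(k : ℝ))) /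
        Real.exp (2 * Real.pi * (p * √(k : ℝ))) * profile k) := by gcongr
    _ = C * ((p : ℝ) ^ 13 * √p) / c / Real.exp (2 * Real.pi * (p * √(k : ℝ))) *
        (c * (Real.exp (4 * Real.pi * (p * √(k : ℝ))) * (profile k / ((p : ℝ) ^ 13 * √p)))) := by
      field_simp
    _ ≤ _ := mul_le_mul_of_nonneg_left h2 (by positivity)

/-! ### Assembly of the corollary -/

theorem norm_delta_div_le {S : Type*} [TopologicalSpace S] {p : ℕ} (hp : 1 ≤ p) (w : VW.H S 2) :
    ‖VW.delta p w 0 / (p : ℂ) ^ 2‖ ≤ 1 := by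
  have h1 : ‖VW.delta p w 0‖ ≤ 1 := by
    unfold VW.delta
    split_ifs <;> simp
  have hp' : (1 : ℝ) ≤ p := by exact_mod_cast hp
  rw [norm_div, norm_pow, Complex.norm_natCast]
  exact div_le_one_of_le₀ (h1.trans (one_le_pow₀ hp')) (by positivity)

theorem isEquivalent_of_norm_sub_le {u v : ℕ → ℂ} {K : ℕ → ℝ} (hK : Tendsto K atTop (𝓝 0))
    (h : ∀ᶠ n in atTop, ‖u n - v n‖ ≤ K n * ‖v n‖) : u ~[atTop] v := by
  refine IsLittleO.of_bound fun c hc => ?_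
  filter_upwards [h, hK.eventually (eventually_le_nhds hc)] with n h1 h2
  exact h1.trans (mul_le_mul_of_nonneg_right h2 (norm_nonneg _))

theorem corollary3p1 (p : ℕ) (hp : p.Prime) :
    ∃ (C : ℝ) (N : ℕ), ∀ (S : Type*) [TopologicalSpace S] [ChartedSpace VW.C2 S],
      VW.IsK3Surface S → ∀ (deg : VW.H S 4 ≃+ ℤ) (w : VW.H S 2) (m : ℤ),
      VW.selfIntersection deg w = 2 * m → (p : ℤ) ∣ m →
      (∀ τ : ℂ, 0 < τ.im →
        HasSum (fun n : ℤ => VW.alpha2' p deg w n * Complex.exp (2 * Real.pi * Complex.I * n * τ))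
          (VW.Z p deg w τ)) ∧
      (∀ n : ℤ, ¬ (p : ℤ) ∣ n → VW.alpha2 p deg w n = 0) ∧
      (∀ n : ℤ, VW.alpha2' p deg w n =
        VW.a (p * n) +
          if (p : ℤ) ∣ n then VW.delta p w 0 / (p : ℂ) ^ 2 * VW.a (n / p) else 0) ∧
      ((fun n : ℕ => VW.alpha2' p deg w n) ~[atTop] fun n : ℕ => VW.a (p * n)) ∧
      (∀ n : ℕ, N ≤ n → ∃ ε : ℂ,
        ‖ε‖ ≤ C / Real.exp (2 * Real.pi * √((p : ℝ) * n)) ∧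
        VW.alpha2' p deg w n =
          ((2 * Real.pi / ((p : ℝ) * n) ^ (13 / 2 : ℝ) *
            VW.besselI 13 (4 * Real.pi * √((p : ℝ) * n)) : ℝ) : ℂ) * (1 + ε)) := by
  have hp0 : p ≠ 0 := hp.ne_zero
  have hpr : (0 : ℝ) < p := by positivity
  obtain ⟨C₁, hC₁, h₁⟩ := exists_norm_a_sub_le_mul_mainTerm
  obtain ⟨C₂, hC₂, h₂⟩ := exists_norm_a_le_mul_mainTerm hp.two_le
  obtain ⟨c, hc, h₃⟩ := exists_le_mainTerm
  have hmul : Tendsto (fun n : ℕ => p * n) atTop atTop :=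
    tendsto_id.const_mul_atTop' (Nat.pos_of_ne_zero hp0)
  have hmulr : Tendsto (fun n : ℕ => (p : ℝ) * n) atTop atTop :=
    tendsto_natCast_atTop_atTop.const_mul_atTop hpr
  have hbig : ∀ᶠ n : ℕ in atTop, 0 < mainTerm ((p : ℝ) * n) ∧
      ‖VW.a (p * n) - mainTerm ((p : ℝ) * n)‖ ≤
        C₁ / Real.exp (2 * Real.pi * √((p : ℝ) * n)) * mainTerm ((p : ℝ) * n) ∧
      ((p : ℤ) ∣ n → ‖VW.a (n / p)‖ ≤
        C₂ / Real.exp (2 * Real.pi * √((p : ℝ) * n)) * mainTerm ((p : ℝ) * n)) := by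
    obtain ⟨N, hN⟩ := eventually_atTop.mp h₂
    filter_upwards [hmulr.eventually h₃, hmulr.eventually (eventually_gt_atTop 0),
      hmul.eventually h₁, eventually_ge_atTop (p * N)] with n e1 e2 e3 e4
    refine ⟨lt_of_lt_of_le ?_ e1, by exact_mod_cast e3, fun hd => ?_⟩
    · have := profile_pos e2
      positivity
    · obtain ⟨k, rfl⟩ := Int.natCast_dvd_natCast.mp hd
      have := hN k (Nat.le_of_mul_le_mul_left e4 (Nat.pos_of_ne_zero hp0))
      have e : ((p * k : ℕ) : ℤ) / (p : ℤ) = k := by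
        rw [Nat.cast_mul, Int.mul_ediv_cancel_left _ (by exact_mod_cast hp0)]
      rwa [e]
  obtain ⟨N, hN⟩ := eventually_atTop.mp hbig
  -- Both constants are fixed before $S$ and $w$ appear. The class $w$ enters the estimate only
  -- through $|\delta_{w,0}/p^2| \le 1$, which gives the uniformity.
  refine ⟨C₁ + C₂, N, fun S _ _ _ deg w m hm hpm => ?_⟩
  have hformula : ∀ n : ℤ, VW.alpha2' p deg w n = VW.a (p * n) +
      if (p : ℤ) ∣ n then VW.delta p w 0 / (p : ℂ) ^ 2 * VW.a (n / p) else 0 := fun n => by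
    rw [VW.alpha2', alpha2_eq hp0 hm hpm, partitionCoeff_mul hp0]
  have hmain : ∀ n : ℕ, N ≤ n → ‖VW.alpha2' p deg w n - mainTerm ((p : ℝ) * n)‖ ≤
      (C₁ + C₂) / Real.exp (2 * Real.pi * √((p : ℝ) * n)) * mainTerm ((p : ℝ) * n) := by
    intro n hn
    obtain ⟨g0, g1, g2⟩ := hN n hn
    rw [hformula, add_sub_right_comm, add_div, add_mul]
    refine (norm_add_le _ _).trans (add_le_add g1 ?_)
    split_ifs with hd
    · rw [norm_mul]
      exact (mul_le_of_le_one_left (norm_nonneg _) (norm_delta_div_le hp.one_le w)).trans (g2 hd)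
    · rw [norm_zero]; positivity
  have hexp : ∀ C : ℝ, Tendsto (fun n : ℕ => C / Real.exp (2 * Real.pi * √((p : ℝ) * n)))
      atTop (𝓝 0) := fun C =>
    (Real.tendsto_exp_atTop.comp ((Real.tendsto_sqrt_atTop.comp hmulr).const_mul_atTop
      (by positivity : 0 < 2 * Real.pi))).const_div_atTop C
  refine ⟨fun τ hτ => hasSum_alpha2' hp0 hm hpm hτ, fun n hn => ?_, hformula, ?_, fun n hn => ?_⟩
  · rw [alpha2_eq hp0 hm hpm, partitionCoeff_of_not_dvd w hn]
  · have r1 : (fun n : ℕ => VW.alpha2' p deg w n) ~[atTop]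
        fun n : ℕ => (mainTerm ((p : ℝ) * n) : ℂ) := by
      refine isEquivalent_of_norm_sub_le (hexp (C₁ + C₂)) ?_
      filter_upwards [eventually_ge_atTop N] with n hn
      rw [Complex.norm_real, Real.norm_of_nonneg (hN n hn).1.le]
      exact hmain n hn
    have r2 : (fun n : ℕ => VW.a (p * n)) ~[atTop]
        fun n : ℕ => (mainTerm ((p : ℝ) * n) : ℂ) := by
      refine isEquivalent_of_norm_sub_le (hexp C₁) ?_
      filter_upwards [eventually_ge_atTop N] with n hn
      rw [Complex.norm_real, Real.norm_of_nonneg (hN n hn).1.le]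
      exact (hN n hn).2.1
    exact r1.trans r2.symm
  · have g0 := (hN n hn).1
    have g1 : (mainTerm ((p : ℝ) * n) : ℂ) ≠ 0 := by exact_mod_cast g0.ne'
    change ∃ ε : ℂ, _ ∧ VW.alpha2' p deg w n = (mainTerm ((p : ℝ) * n) : ℂ) * (1 + ε)
    refine ⟨(VW.alpha2' p deg w n - mainTerm ((p : ℝ) * n)) / mainTerm ((p : ℝ) * n), ?_, ?_⟩
    · rw [norm_div, Complex.norm_real, Real.norm_of_nonneg g0.le, div_le_iff₀ g0]
      exact hmain n hn
    · field_simp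
      ring
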